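/- **Model.** Let $C,D\ge 1$ be integers, $a=(a_{c,d})\in\mathbb R_{\ge 0}^{C\times D}$ a non-negative matrix, $\nu$ a probability distribution on $[D]$, and $\alpha>0$. There are $N>\max_{c,d}a_{c,d}$ offline nodes; node $n$ has a class $c(n)\in[C]$, and $b_c$ denotes the proportion of offline nodes of class $c$ (the classes are arbitrary and fixed, i.e. we condition on them). There are $T=\alpha N$ online nodes, which arrive one by one and have independent classes $d(t)\in[D]$ of law $\nu$. Given the classes, the edges $(n,t)$ are present independently, with probability $a_{c(n),d(t)}/N$. Let $M_c(t)$ be the number of offline nodes of class $c$ matched after $t$ arrivals, so $M_c(0)=0$. At each arrival the algorithm *Balance* selects, on the basis of the past, a class maximizing $\sum_{d}\bigl(1-(1-\tfrac{a_{c,d}}N)^{Nb_c-M_c}\bigr)\nu(d)$ over $c\in[C]$, where $M_c$ is the current matching size of class $c$ (ties are broken by an arbitrary rule that depends on the past); if the arriving node has unmatched neighbours in the selected class, it is matched to one of them, chosen uniformly at random, and otherwise it stays unmatched. **Differential inclusion.** For $b\in\mathbb R_{\ge0}^C$ put $f_{c,b_c}(x)=\sum_{d}(1-e^{-a_{c,d}(b_c-x)})\nu(d)$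 and $$F(m)=\operatorname{conv}\Bigl\{f_{c,b_c}(m_c)\,e_c\;:\;c\in\operatorname*{argmax}_{k\in[C]}f_{k,b_k}(m_k)\Bigr\},\qquad m\in\mathbb R^C .$$ A solution of $\dot m\in F(m)$ on $[0,\alpha]$ with $m(0)=0$ is a function $m$ for which there is an integrable $\varphi$ with $m(t)=\int_0^t\varphi(s)\,ds$ for all $t\in[0,\alpha]$ and $\varphi(t)\in F(m(t))$ for almost every $t\in[0,\alpha]$. **Theorem.** (i) For every $b\in\mathbb R_{\ge0}^C$ the differential inclusion $\dot m\in F(m)$, $m(0)=0$, has a unique solution on $[0,\alpha]$. (ii) There is $N_0$, depending only on $C,D,a,\nu,\alpha$, such that the following holds for all $N\ge N_0$ with $N>\max_{c,d} a_{c,d}$ and $T=\alpha N$ an integer, for all classes of the offline nodes, and for every tie-breaking rule. Let $m$ be the solution in (i) for the vector $b$ of class proportions, and let $\sigma>0$ be a constant with $\mathbb E[|Q_c(t+1)|^2\mid\text{past up to }t]\le \sigma$ almost surely for all $c\in[C]$ and $0\le t<T$, where $Q_c(t+1)=M_c(t+1)-M_c(t)-\mathbb E[M_c(t+1)-M_c(t)\mid\text{past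 up to }t]$. Then for every $\varepsilon>0$, with probability at least $1-\frac{\sigma\alpha}{N\varepsilon^2}$, simultaneously for all $0\le t\le T$ and all $c\in[C]$ with $\min_d a_{c,d}>0$, $$\left|\frac{M_c(t)}N-m_c\!\left(\frac tN\right)\right|\le\min\!\left(\alpha,\frac{e^{L\alpha}}{\sqrt{2L}}\right)\sqrt{\frac{A_{\alpha,c}}N+\delta_cB_{\alpha,c}+\varepsilon C_{\alpha,c}} .$$ Here $L=\max_{c}\sum_d a_{c,d}\nu(d)$, $\delta_c=\frac1N\sum_d\frac{a_{c,d}}e\nu(d)$, $U_c=\sum_d(1-e^{-a_{c,d}b_c})\nu(d)$, $\gamma_c=\ln\bigl(1-\frac{\min_d a_{c,d}}N\bigr)$, $\kappa_c=\max\bigl(|1-e^{\gamma_cNb_c}|,|\gamma_ce^{\gamma_cNb_c}|\bigr)$, $K_{\alpha,c}=(\kappa_c\alpha+\varepsilon)e^{\kappa_c\alpha}/\kappa_c$, $A_{\alpha,c}=U_c\bigl(U_c^2+\frac{14U_c}3+2K_{\alpha,c}\bigr)$, $B_{\alpha,c}=2U_c^2+4L\delta_c+12K_{\alpha,c}$,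 $C_{\alpha,c}=2U_c^2+4L\varepsilon+8K_{\alpha,c}$. -/

import Mathlib

open scoped BigOperators

noncomputable section

namespace BalanceSBM

/-! ### The differential inclusion -/

/-- `f_{c,β}(x) = ∑_d (1 - exp(-a_{c,d} (β - x))) ν(d)`. -/
def fluidRate {C D : ℕ} (a : Fin C → Fin D → ℝ) (ν : PMF (Fin D)) (c : Fin C) (β x : ℝ) : ℝ :=
  ∑ d, (1 - Real.exp (-(a c d * (β - x)))) * (ν d).toReal

/-- `F(m)`: the convex hull of the vectors `f_{c,b_c}(m_c) e_c`, for the classes `c` that maximize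
`f_{k,b_k}(m_k)` over all classes `k`. -/
def fluidField {C D : ℕ} (a : Fin C → Fin D → ℝ) (ν : PMF (Fin D)) (b : Fin C → ℝ)
    (m : Fin C → ℝ) : Set (Fin C → ℝ) :=
  convexHull ℝ {v | ∃ c : Fin C,
    (∀ k, fluidRate a ν k (b k) (m k) ≤ fluidRate a ν c (b c) (m c)) ∧
      v = Pi.single c (fluidRate a ν c (b c) (m c))}

/-- `x` solves `ẋ ∈ F(x)` on `[0, τ]` with `x(0) = x₀`: there is an integrable `φ` with
`x(t) = x₀ + ∫₀ᵗ φ` for all `t ∈ [0, τ]` and `φ(t) ∈ F(x(t))` for almost every `t ∈ [0, τ]`. -/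
def SolvesInclusion {C : ℕ} (F : (Fin C → ℝ) → Set (Fin C → ℝ)) (τ : ℝ) (x₀ : Fin C → ℝ)
    (x : ℝ → Fin C → ℝ) : Prop :=
  ∃ φ : ℝ → Fin C → ℝ, IntervalIntegrable φ MeasureTheory.volume 0 τ ∧
    (∀ t ∈ Set.Icc 0 τ, x t = x₀ + ∫ s in (0 : ℝ)..t, φ s) ∧
    ∀ᵐ t ∂(MeasureTheory.volume.restrict (Set.Icc 0 τ)), φ t ∈ F (x t)

/-! ### The stochastic block model and the Balance algorithm -/

/-- The number of offline nodes of class `c`; `cls n` is the class of the offline node `n`. -/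
def classSize {N C : ℕ} (cls : Fin N → Fin C) (c : Fin C) : ℕ :=
  (Finset.univ.filter fun n => cls n = c).card

/-- `b_c`, the proportion of offline nodes of class `c`. -/
def proportion {N C : ℕ} (cls : Fin N → Fin C) (c : Fin C) : ℝ := (classSize cls c : ℝ) / N

/-- `M_c`, the number of matched nodes of class `c`, when `S` is the set of matched offline
nodes. -/
def matchedSize {N C : ℕ} (cls : Fin N → Fin C) (S : Finset (Fin N)) (c : Fin C) : ℕ :=
  (S.filter fun n => cls n = c).card

/-- `∑_d (1 - (1 - a_{c,d}/N)^(N b_c - M_c)) ν(d)`, the quantity that Balance maximizes over `c`.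
The subtraction in the exponent never truncates, as `M_c ≤ N b_c`. -/
def balanceScore {N C D : ℕ} (a : Fin C → Fin D → ℝ) (ν : PMF (Fin D)) (cls : Fin N → Fin C)
    (S : Finset (Fin N)) (c : Fin C) : ℝ :=
  ∑ d, (1 - (1 - a c d / N) ^ (classSize cls c - matchedSize cls S c)) * (ν d).toReal

/-- The law of a random subset of `Fin N` that contains each `n` independently with
probability `p n`. -/
def randomSubset {N : ℕ} (p : Fin N → unitInterval) : PMF (Finset (Fin N)) :=
  PMF.ofFintype
    (fun E => (∏ n ∈ E, ENNReal.ofReal (p n)) * ∏ n ∈ Finset.univ \ E, ENNReal.ofReal (1 - p n))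
    (by
      have h := Finset.prod_add (fun n => ENNReal.ofReal (p n : ℝ))
        (fun n => ENNReal.ofReal (1 - (p n : ℝ))) (Finset.univ : Finset (Fin N))
      rw [Finset.powerset_univ] at h
      rw [← h]
      refine Finset.prod_eq_one fun n _ => ?_
      rw [← ENNReal.ofReal_add (p n).2.1 (sub_nonneg.2 (p n).2.2)]
      simp)

/-- The edge probability `a_{c,d}/N` (it lies in `[0,1]` when `0 ≤ a_{c,d} ≤ N`, and then the
projection does nothing). -/
def edgeProb {C D : ℕ} (N : ℕ) (a : Fin C → Fin D → ℝ) (c : Fin C) (d : Fin D) : unitInterval :=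
  Set.projIcc 0 1 zero_le_one (a c d / N)

/-- The law of the set of matched offline nodes after the arrival of one online node, when `S` is
the set matched before and the algorithm has selected the class `c`: the arriving node has a random
class `d` of law `ν`, it is adjacent to each offline node `n` independently with probability
`a_{cls n, d}/N`, and if it has unmatched neighbours of class `c`, then it is matched to one of
them, chosen uniformly at random. -/
def arrival {N C D : ℕ} (a : Fin C → Fin D → ℝ) (ν : PMF (Fin D)) (cls : Fin N → Fin C)
    (S : Finset (Fin N)) (c : Fin C) : PMF (Finset (Fin N)) :=
  ν.bind fun d => (randomSubset fun n => edgeProb N a (cls n) d).bind fun E =>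
    if h : (E.filter fun n => n ∉ S ∧ cls n = c).Nonempty then
      (PMF.uniformOfFinset _ h).map fun n => insert n S
    else PMF.pure S

/-- A class selection rule, given as a function of the number `t` of past arrivals and the
trajectory `ω` of the set of matched nodes up to then (`ω s` is the set after `s` arrivals), follows
Balance if it always selects a maximizer of the score; ties are broken arbitrarily. -/
def IsBalanceRule {N C D : ℕ} (a : Fin C → Fin D → ℝ) (ν : PMF (Fin D)) (cls : Fin N → Fin C)
    (sel : ℕ → (ℕ → Finset (Fin N)) → Fin C) : Prop :=
  ∀ t ω k, balanceScore a ν cls (ω t) k ≤ balanceScore a ν cls (ω t) (sel t ω)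

/-- The law of the trajectory of the set of matched nodes over the first `T` arrivals. Under it
`ω s` is the set after `s` arrivals for `s ≤ T`, and `ω s = ω T` for `s ≥ T`. The edges at distinct
online nodes are independent, so they are drawn when the online node arrives. -/
def run {N C D : ℕ} (a : Fin C → Fin D → ℝ) (ν : PMF (Fin D)) (cls : Fin N → Fin C)
    (sel : ℕ → (ℕ → Finset (Fin N)) → Fin C) : ℕ → PMF (ℕ → Finset (Fin N))
  | 0 => PMF.pure fun _ => ∅
  | T + 1 => (run a ν cls sel T).bind fun ω =>
      (arrival a ν cls (ω T) (sel T ω)).map fun S s => if s ≤ T then ω s else S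

/-- The conditional expectation of `M_c(t+1) - M_c(t)`, when `S` is the set of nodes matched after
`t` arrivals and the class `c'` is selected for the next one. -/
def drift {N C D : ℕ} (a : Fin C → Fin D → ℝ) (ν : PMF (Fin D)) (cls : Fin N → Fin C)
    (S : Finset (Fin N)) (c' c : Fin C) : ℝ :=
  ∑ S', (arrival a ν cls S c' S').toReal * ((matchedSize cls S' c : ℝ) - matchedSize cls S c)

/-- The conditional second moment of the martingale difference
`Q_c(t+1) = M_c(t+1) - M_c(t) - E[M_c(t+1) - M_c(t) | past]`, when `S` is the set of nodes matched
after `t` arrivals and the class `c'` is selected for the next one. -/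
def noiseSecondMoment {N C D : ℕ} (a : Fin C → Fin D → ℝ) (ν : PMF (Fin D)) (cls : Fin N → Fin C)
    (S : Finset (Fin N)) (c' c : Fin C) : ℝ :=
  ∑ S', (arrival a ν cls S c' S').toReal *
    ((matchedSize cls S' c : ℝ) - matchedSize cls S c - drift a ν cls S c' c) ^ 2

/-- `σ` bounds the conditional second moments `E[|Q_c(t+1)|² | past]`, almost surely, for all
classes `c` and all times `t < T`. -/
def NoiseBound {N C D : ℕ} (a : Fin C → Fin D → ℝ) (ν : PMF (Fin D)) (cls : Fin N → Fin C)
    (sel : ℕ → (ℕ → Finset (Fin N)) → Fin C) (T : ℕ) (σ : ℝ) : Prop :=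
  ∀ t < T, ∀ ω ∈ (run a ν cls sel t).support, ∀ c,
    noiseSecondMoment a ν cls (ω t) (sel t ω) c ≤ σ

/-! ### The constants of the error bound -/

/-- `L = max_c ∑_d a_{c,d} ν(d)`. -/
def lipConst {C D : ℕ} (a : Fin C → Fin D → ℝ) (ν : PMF (Fin D)) : ℝ :=
  ⨆ c, ∑ d, a c d * (ν d).toReal

/-- `δ_c = (1/N) ∑_d (a_{c,d}/e) ν(d)`. -/
def biasConst {C D : ℕ} (N : ℕ) (a : Fin C → Fin D → ℝ) (ν : PMF (Fin D)) (c : Fin C) : ℝ :=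
  1 / N * ∑ d, a c d / Real.exp 1 * (ν d).toReal

/-- `γ_c = log(1 - min_d a_{c,d} / N)`. -/
def logConst {C D : ℕ} (N : ℕ) (a : Fin C → Fin D → ℝ) (c : Fin C) : ℝ :=
  Real.log (1 - (⨅ d, a c d) / N)

/-- `κ_c = max(|1 - e^{γ_c N b_c}|, |γ_c e^{γ_c N b_c}|)`. -/
def growthConst {C D : ℕ} (N : ℕ) (a : Fin C → Fin D → ℝ) (b : Fin C → ℝ) (c : Fin C) : ℝ :=
  max |1 - Real.exp (logConst N a c * (N * b c))|
    |logConst N a c * Real.exp (logConst N a c * (N * b c))|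

/-- `K_{α,c} = (κ_c α + ε) e^{κ_c α} / κ_c`. -/
def kConst {C D : ℕ} (N : ℕ) (a : Fin C → Fin D → ℝ) (b : Fin C → ℝ) (α ε : ℝ) (c : Fin C) : ℝ :=
  (growthConst N a b c * α + ε) * Real.exp (growthConst N a b c * α) / growthConst N a b c

/-- `U_c = ∑_d (1 - e^{-a_{c,d} b_c}) ν(d)`. -/
def uConst {C D : ℕ} (a : Fin C → Fin D → ℝ) (ν : PMF (Fin D)) (b : Fin C → ℝ) (c : Fin C) : ℝ :=
  ∑ d, (1 - Real.exp (-(a c d * b c))) * (ν d).toReal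

/-- `A_{α,c} = U_c (U_c² + 14 U_c / 3 + 2 K_{α,c})`. -/
def aConst {C D : ℕ} (N : ℕ) (a : Fin C → Fin D → ℝ) (ν : PMF (Fin D)) (b : Fin C → ℝ) (α ε : ℝ)
    (c : Fin C) : ℝ :=
  uConst a ν b c * (uConst a ν b c ^ 2 + 14 * uConst a ν b c / 3 + 2 * kConst N a b α ε c)

/-- `B_{α,c} = 2 U_c² + 4 L δ_c + 12 K_{α,c}`. -/
def bConst {C D : ℕ} (N : ℕ) (a : Fin C → Fin D → ℝ) (ν : PMF (Fin D)) (b : Fin C → ℝ) (α ε : ℝ)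
    (c : Fin C) : ℝ :=
  2 * uConst a ν b c ^ 2 + 4 * lipConst a ν * biasConst N a ν c + 12 * kConst N a b α ε c

/-- `C_{α,c} = 2 U_c² + 4 L ε + 8 K_{α,c}`. -/
def cConst {C D : ℕ} (N : ℕ) (a : Fin C → Fin D → ℝ) (ν : PMF (Fin D)) (b : Fin C → ℝ) (α ε : ℝ)
    (c : Fin C) : ℝ :=
  2 * uConst a ν b c ^ 2 + 4 * lipConst a ν * ε + 8 * kConst N a b α ε c

/-- `min(α, e^{Lα}/√(2L)) √(A_{α,c}/N + δ_c B_{α,c} + ε C_{α,c})`. -/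
def errorBound {C D : ℕ} (N : ℕ) (a : Fin C → Fin D → ℝ) (ν : PMF (Fin D)) (b : Fin C → ℝ)
    (α ε : ℝ) (c : Fin C) : ℝ :=
  min α (Real.exp (lipConst a ν * α) / Real.sqrt (2 * lipConst a ν)) *
    Real.sqrt (aConst N a ν b α ε c / N + biasConst N a ν c * bConst N a ν b α ε c +
      ε * cConst N a ν b α ε c)

end BalanceSBM

end

namespace BalanceSBM

open MeasureTheory Set

/-! ### Greedy fields and fillings -/

/-! The greedy dynamics reduces to one scalar quantity, the total of the coordinates. A class grows
only while its rate is maximal, and rates decrease as classes fill, so the nonempty classes always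
maximize the rate: the state is a filling (`SolvesInclusion.isFilling`). Since active rates decrease
with slope at least `ℓ`, any two exact fillings are ordered coordinatewise. Hence a filling is
determined by its total (`IsFilling.abs_sub_le`), and a larger total has a smaller maximal rate
(`IsFilling.iSup_le_iSup`); both survive a tolerance.

The total of a solution thus obeys a scalar equation with decreasing right-hand side, so two
solutions cannot separate. For existence, the exact fillings form a curve parametrized by the total
(`RateFamily.exists_curve`); Picard-Lindelöf gives the total, and the curve lifts it to a solution.

A trajectory of Balance is a filling with tolerance of order 1/N (`IsPath.isFilling`). The same
monotonicity, in place of a Gronwall argument, bounds its distance to the fluid limit by 2/N times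
the largest fluctuation of the compensated number of matches, plus O(1/N) (`IsPath.abs_sub_le`).
That fluctuation is a martingale with centred Bernoulli increments, controlled by the fourth moment
of a stopped version (`toOuterMeasure_noise_le`). The required error bound is at least r√(ε + 1/N)
(`exists_mul_sqrt_le_errorBound`), so the failure probability is O(σα/(N²ε²)); the spare factor 1/N
absorbs every constant once N is large. -/

/-- Decreasing rate functions `f c`, vanishing at `b c`, that are identically zero for the inactive
indices and have slopes between `ℓ` and `Λ` on `[0, b c]` for the active ones. -/
structure RateFamily {ι : Type*} (f : ι → ℝ → ℝ) (b : ι → ℝ) (act : ι → Prop) (ℓ Λ : ℝ) : Prop where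
  pos : 0 < ℓ
  slope_nonneg : 0 ≤ Λ
  nonneg : ∀ c, 0 ≤ b c
  continuous : ∀ c, Continuous (f c)
  antitone : ∀ c, Antitone (f c)
  apply_eq_zero : ∀ c, f c (b c) = 0
  inactive : ∀ c, ¬ act c → ∀ x, f c x = 0
  le_one : ∀ c, f c 0 ≤ 1
  lower : ∀ c, act c → ∀ x y, 0 ≤ x → x ≤ y → y ≤ b c → ℓ * (y - x) ≤ f c x - f c y
  upper : ∀ c x y, 0 ≤ x → x ≤ y → y ≤ b c → f c x - f c y ≤ Λ * (y - x)

/-- `x` is a filling with tolerance `ρ` if the indices with `0 < x c` are active and maximize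
`f k (x k)` up to `ρ`. -/
structure IsFilling {ι : Type*} (f : ι → ℝ → ℝ) (b : ι → ℝ) (act : ι → Prop) (ρ : ℝ)
    (x : ι → ℝ) : Prop where
  nonneg : ∀ c, 0 ≤ x c
  le : ∀ c, x c ≤ b c
  active : ∀ c, 0 < x c → act c
  le_add : ∀ c, 0 < x c → ∀ k, f k (x k) ≤ f c (x c) + ρ

/-! ### Fillings are ordered by their totals -/

section Filling

variable {ι : Type*} {f : ι → ℝ → ℝ} {b : ι → ℝ} {act : ι → Prop} {ℓ Λ ρ θ : ℝ} {x y : ι → ℝ}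

theorem RateFamily.apply_nonneg (hf : RateFamily f b act ℓ Λ) {c : ι} {t : ℝ} (h : t ≤ b c) :
    0 ≤ f c t := by
  rw [← hf.apply_eq_zero c]; exact hf.antitone c h

theorem RateFamily.apply_nonpos (hf : RateFamily f b act ℓ Λ) {c : ι} {t : ℝ} (h : b c ≤ t) :
    f c t ≤ 0 := by
  rw [← hf.apply_eq_zero c]; exact hf.antitone c h

theorem RateFamily.apply_le_one (hf : RateFamily f b act ℓ Λ) {c : ι} {t : ℝ} (h : 0 ≤ t) :
    f c t ≤ 1 := (hf.antitone c h).trans (hf.le_one c)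

theorem IsFilling.mono (hx : IsFilling f b act ρ x) {ρ' : ℝ} (h : ρ ≤ ρ') :
    IsFilling f b act ρ' x :=
  ⟨hx.nonneg, hx.le, hx.active, fun c hc k => (hx.le_add c hc k).trans (by linarith)⟩

/-- The differences of two fillings have the same sign up to the tolerance. -/
theorem IsFilling.le_add_of_lt (hf : RateFamily f b act ℓ Λ) (hx : IsFilling f b act (ℓ * θ) x)
    (hy : IsFilling f b act (ℓ * θ) y) (hθ : 0 ≤ θ) {c : ι} (hc : y c + θ < x c) (k : ι) :
    y k ≤ x k + θ := by
  by_contra! hk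
  have hxc : 0 < x c := by linarith [hy.nonneg c]
  have hyk : 0 < y k := by linarith [hx.nonneg k]
  have h1 := hf.lower c (hx.active c hxc) (y c) (x c) (hy.nonneg c) (by linarith) (hx.le c)
  have h2 := hf.lower k (hy.active k hyk) (x k) (y k) (hx.nonneg k) (by linarith) (hy.le k)
  have h3 := hx.le_add c hxc k
  have h4 := hy.le_add k hyk c
  have h5 : ℓ * θ < ℓ * (x c - y c) := mul_lt_mul_of_pos_left (by linarith) hf.pos
  have h6 : ℓ * θ < ℓ * (y k - x k) := mul_lt_mul_of_pos_left (by linarith) hf.pos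
  linarith

theorem IsFilling.iSup_le_one [Nonempty ι] (hf : RateFamily f b act ℓ Λ)
    (hx : IsFilling f b act ρ x) : ⨆ k, f k (x k) ≤ 1 :=
  ciSup_le fun k => hf.apply_le_one (hx.nonneg k)

variable [Fintype ι]

/-- If one coordinate of `x` exceeds that of `y` by more than `θ`, then every `x k - y k + θ` is
nonnegative, so a single term is at most the sum of all. -/
theorem IsFilling.sub_le (hf : RateFamily f b act ℓ Λ) (hx : IsFilling f b act (ℓ * θ) x)
    (hy : IsFilling f b act (ℓ * θ) y) (hθ : 0 ≤ θ) (c : ι) :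
    x c - y c ≤ |∑ k, x k - ∑ k, y k| + Fintype.card ι * θ := by
  have h0 : 0 < Fintype.card ι := Fintype.card_pos_iff.2 ⟨c⟩
  have h1 : (1 : ℝ) ≤ Fintype.card ι := by exact_mod_cast h0
  rcases le_or_gt (x c) (y c + θ) with h | h
  · have := abs_nonneg (∑ k, x k - ∑ k, y k)
    nlinarith
  · have hs := Finset.single_le_sum (f := fun k => x k - y k + θ) (s := Finset.univ)
      (fun k _ => by have := hx.le_add_of_lt hf hy hθ h k; linarith) (Finset.mem_univ c)
    simp only [Finset.sum_add_distrib, Finset.sum_sub_distrib, Finset.sum_const, Finset.card_univ,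
      nsmul_eq_mul] at hs
    linarith [le_abs_self (∑ k, x k - ∑ k, y k)]

theorem IsFilling.abs_sub_le (hf : RateFamily f b act ℓ Λ) (hx : IsFilling f b act (ℓ * θ) x)
    (hy : IsFilling f b act (ℓ * θ) y) (hθ : 0 ≤ θ) (c : ι) :
    |x c - y c| ≤ |∑ k, x k - ∑ k, y k| + Fintype.card ι * θ := by
  refine abs_le'.2 ⟨hx.sub_le hf hy hθ c, ?_⟩
  have := hy.sub_le hf hx hθ c
  rw [abs_sub_comm (∑ k, x k)]
  linarith

theorem apply_le_iSup (f : ι → ℝ → ℝ) (x : ι → ℝ) (k : ι) : f k (x k) ≤ ⨆ k, f k (x k) :=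
  le_ciSup (f := fun k => f k (x k)) (Set.finite_range _).bddAbove k

/-- This is the contraction principle behind both uniqueness and concentration. A large enough
excess in total forces an excess above `θ` in some coordinate `c`; there `x` is maximal up to `ℓ *
θ`, and the slope `ℓ` makes the drop of `f c` pay for that tolerance. -/
theorem IsFilling.iSup_le_iSup [Nonempty ι] (hf : RateFamily f b act ℓ Λ)
    (hx : IsFilling f b act (ℓ * θ) x) (hy : IsFilling f b act (ℓ * θ) y) (hθ : 0 ≤ θ)
    (h : ∑ k, y k + Fintype.card ι * θ < ∑ k, x k) :
    ⨆ k, f k (x k) ≤ ⨆ k, f k (y k) := by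
  obtain ⟨c, -, hc⟩ : ∃ c ∈ Finset.univ, y c + θ < x c := by
    refine Finset.exists_lt_of_sum_lt ?_
    simpa [Finset.sum_add_distrib] using h
  have hxc : 0 < x c := by linarith [hy.nonneg c]
  have h1 := hf.lower c (hx.active c hxc) (y c) (x c) (hy.nonneg c) (by linarith) (hx.le c)
  have h5 : ℓ * θ < ℓ * (x c - y c) := mul_lt_mul_of_pos_left (by linarith) hf.pos
  refine ciSup_le fun k => ?_
  linarith [hx.le_add c hxc k, apply_le_iSup f y c]

theorem IsFilling.iSup_nonneg [Nonempty ι] (hf : RateFamily f b act ℓ Λ)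
    (hx : IsFilling f b act ρ x) : 0 ≤ ⨆ k, f k (x k) := by
  obtain ⟨c⟩ := ‹Nonempty ι›
  exact (hf.apply_nonneg (hx.le c)).trans (apply_le_iSup f x c)

end Filling

/-! ### The convex hull of the greedy velocities -/

section Field

variable {ι : Type*} [DecidableEq ι]

/-- The convex hull of the vectors `f c (x c) e_c` over the maximizers `c` of `f c (x c)`. -/
def greedyField (f : ι → ℝ → ℝ) (x : ι → ℝ) : Set (ι → ℝ) :=
  convexHull ℝ {v | ∃ c : ι, (∀ k, f k (x k) ≤ f c (x c)) ∧ v = Pi.single c (f c (x c))}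

variable {f : ι → ℝ → ℝ} {x v : ι → ℝ}

theorem eq_zero_of_mem_greedyField (hv : v ∈ greedyField f x) {c k : ι}
    (h : f c (x c) < f k (x k)) : v c = 0 := by
  have : greedyField f x ⊆ {v | v c = 0} := by
    refine convexHull_min ?_ ?_
    · rintro _ ⟨j, hj, rfl⟩
      have : c ≠ j := by rintro rfl; exact absurd (hj k) (not_le.2 h)
      simp [this]
    · intro u hu w hw p q _ _ _
      simp_all
  exact this hv

theorem nonneg_of_mem_greedyField (hv : v ∈ greedyField f x) {c : ι}
    (h : 0 ≤ f c (x c)) : 0 ≤ v c := by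
  have : greedyField f x ⊆ {v | 0 ≤ v c} := by
    refine convexHull_min ?_ ?_
    · rintro _ ⟨j, hj, rfl⟩
      rcases eq_or_ne c j with rfl | hc
      · simpa
      · simp [hc]
    · intro u hu w hw p q hp hq _
      simp only [Set.mem_ofPred_eq, Pi.add_apply, Pi.smul_apply, smul_eq_mul] at *
      positivity
  exact this hv

theorem nonpos_of_mem_greedyField (hv : v ∈ greedyField f x) {c : ι}
    (h : f c (x c) ≤ 0) : v c ≤ 0 := by
  have : greedyField f x ⊆ {v | v c ≤ 0} := by
    refine convexHull_min ?_ ?_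
    · rintro _ ⟨j, hj, rfl⟩
      rcases eq_or_ne c j with rfl | hc
      · simpa
      · simp [hc]
    · intro u hu w hw p q hp hq _
      simp only [Set.mem_ofPred_eq, Pi.add_apply, Pi.smul_apply, smul_eq_mul] at *
      nlinarith [mul_nonneg hp (neg_nonneg.2 hu), mul_nonneg hq (neg_nonneg.2 hw)]
  exact this hv

variable [Fintype ι]

theorem sum_eq_of_mem_greedyField (hv : v ∈ greedyField f x) :
    ∑ c, v c = ⨆ k, f k (x k) := by
  have : greedyField f x ⊆ {v | ∑ c, v c = ⨆ k, f k (x k)} := by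
    refine convexHull_min ?_ ?_
    · rintro _ ⟨j, hj, rfl⟩
      have : Nonempty ι := ⟨j⟩
      simp only [Set.mem_ofPred_eq, Finset.sum_pi_single', Finset.mem_univ, if_true]
      exact le_antisymm (apply_le_iSup f x j) (ciSup_le hj)
    · intro u hu w hw p q hp hq hpq
      simp only [Set.mem_ofPred_eq, Pi.add_apply, Pi.smul_apply, smul_eq_mul,
        Finset.sum_add_distrib, ← Finset.mul_sum] at *
      rw [hu, hw, ← add_mul, hpq, one_mul]
  exact this hv

/-- The weights of the convex combination are the coordinates of `v` divided by the maximal rate.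
When that rate is zero, `v` vanishes and is itself the generator of any maximizer. -/
theorem mem_greedyField [Nonempty ι] (h0 : ∀ c, 0 ≤ v c)
    (hmax : ∀ c, v c ≠ 0 → ∀ k, f k (x k) ≤ f c (x c)) (hsum : ∑ c, v c = ⨆ k, f k (x k)) :
    v ∈ greedyField f x := by
  obtain ⟨c₀, hc₀⟩ := exists_eq_ciSup_of_finite (f := fun k => f k (x k))
  have hmem : ∀ c, (∀ k, f k (x k) ≤ f c (x c)) →
      (Pi.single c (⨆ k, f k (x k)) : ι → ℝ) ∈ greedyField f x := fun c hc =>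
    subset_convexHull ℝ _ ⟨c, hc, by
      rw [le_antisymm (ciSup_le hc) (apply_le_iSup f x c)]⟩
  set g := ⨆ k, f k (x k) with hg
  rcases eq_or_ne g 0 with h | h
  · have hv : v = 0 := by
      funext c
      exact (Finset.sum_eq_zero_iff_of_nonneg fun c _ => h0 c).1 (hsum.trans h) c
        (Finset.mem_univ c)
    have := hmem c₀ fun k => (apply_le_iSup f x k).trans hc₀.ge
    rw [hv]
    simpa [h] using this
  · have hgpos : 0 < g := lt_of_le_of_ne (hsum ▸ Finset.sum_nonneg fun c _ => h0 c) h.symm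
    have hv : v = ∑ c ∈ Finset.univ.filter fun c => v c ≠ 0,
        (v c / g) • (Pi.single c g : ι → ℝ) := by
      rw [Finset.sum_filter_of_ne (p := fun c => v c ≠ 0)]
      · funext k
        simp [Finset.sum_apply, Pi.single_apply, h]
      · intro c _ hc hvc
        exact hc (by simp [hvc])
    rw [hv]
    refine (convex_convexHull ℝ _).sum_mem (fun c _ => div_nonneg (h0 c) hgpos.le) ?_
      fun c hc => hmem c (hmax c (Finset.mem_filter.1 hc).2)
    rw [← Finset.sum_div, Finset.sum_filter_ne_zero, hsum, div_self h]

end Field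

/-! ### Solutions of the greedy inclusion -/

/-- After the last time `u` with `E u ≤ 0` the function stays positive, so its derivative is almost
everywhere nonpositive and it cannot have risen. -/
theorem nonpos_of_barrier {τ : ℝ} {ψ E : ℝ → ℝ} (hψ : IntervalIntegrable ψ volume 0 τ)
    (hE : ∀ t ∈ Icc 0 τ, E t = E 0 + ∫ s in (0 : ℝ)..t, ψ s) (h0 : E 0 ≤ 0)
    (hneg : ∀ᵐ t ∂(volume.restrict (Icc 0 τ)), 0 < E t → ψ t ≤ 0) :
    ∀ t ∈ Icc 0 τ, E t ≤ 0 := by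
  intro t ht
  by_contra! hpos
  have hcont : ContinuousOn E (Icc 0 τ) := by
    refine ContinuousOn.congr ?_ hE
    have := intervalIntegral.continuousOn_primitive_interval
      (μ := volume) (f := ψ) (a := 0) (b := τ) ?_
    · rw [uIcc_of_le (ht.1.trans ht.2)] at this
      exact continuousOn_const.add this
    · rw [uIcc_of_le (ht.1.trans ht.2)]
      exact (intervalIntegrable_iff_integrableOn_Icc_of_le (ht.1.trans ht.2)).1 hψ
  have hsub : Icc 0 t ⊆ Icc 0 τ := Icc_subset_Icc_right ht.2
  have hK : IsCompact (Icc 0 t ∩ E ⁻¹' Iic 0) :=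
    isCompact_Icc.of_isClosed_subset
      ((hcont.mono hsub).preimage_isClosed_of_isClosed isClosed_Icc isClosed_Iic) inter_subset_left
  obtain ⟨u, ⟨⟨hu0, hut⟩, huE⟩, hgr⟩ := hK.exists_isGreatest ⟨0, ⟨le_rfl, ht.1⟩, h0⟩
  have hint : ∀ s ∈ Icc 0 τ, IntervalIntegrable ψ volume 0 s := fun s hs =>
    hψ.mono_set (uIcc_subset_uIcc_left (by rwa [uIcc_of_le (hs.1.trans hs.2)]))
  have hu : u ∈ Icc 0 τ := hsub ⟨hu0, hut⟩
  have h1 : E t = E u + ∫ s in u..t, ψ s := by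
    rw [hE t ht, hE u hu, add_assoc,
      intervalIntegral.integral_add_adjacent_intervals (hint u hu) ((hint u hu).symm.trans
        (hint t ht))]
  have h2 : ∫ s in u..t, ψ s ≤ 0 := by
    rw [intervalIntegral.integral_of_le hut]
    refine integral_nonpos_of_ae ?_
    have h3 : ∀ᵐ s ∂(volume.restrict (Ioc u t)), 0 < E s → ψ s ≤ 0 :=
      ae_restrict_of_ae_restrict_of_subset
        (Ioc_subset_Icc_self.trans (Icc_subset_Icc hu0 ht.2)) hneg
    filter_upwards [h3, ae_restrict_mem measurableSet_Ioc] with s hs hsm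
    refine hs ?_
    by_contra! hle
    exact absurd (hgr ⟨⟨hu0.trans hsm.1.le, hsm.2⟩, hle⟩) (not_le.2 hsm.1)
  have h4 : E u ≤ 0 := huE
  linarith

section Solution

variable {C : ℕ} {f : Fin C → ℝ → ℝ} {b : Fin C → ℝ} {act : Fin C → Prop} {ℓ Λ τ : ℝ}
  {m m' : ℝ → Fin C → ℝ}

theorem SolvesInclusion.exists_coord {F : (Fin C → ℝ) → Set (Fin C → ℝ)}
    (hm : SolvesInclusion F τ 0 m) :
    ∃ φ : ℝ → Fin C → ℝ, (∀ c, IntervalIntegrable (fun s => φ s c) volume 0 τ) ∧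
      (∀ t ∈ Icc 0 τ, ∀ c, m t c = ∫ s in (0 : ℝ)..t, φ s c) ∧
      ∀ᵐ t ∂(volume.restrict (Icc 0 τ)), φ t ∈ F (m t) := by
  obtain ⟨φ, hφ, hmφ, hF⟩ := hm
  have hc : ∀ c, IntervalIntegrable (fun s => φ s c) volume 0 τ := fun c =>
    ⟨hφ.1.eval c, hφ.2.eval c⟩
  refine ⟨φ, hc, fun t ht c => ?_, hF⟩
  have hφt : IntervalIntegrable φ volume 0 t :=
    hφ.mono_set (uIcc_subset_uIcc_left (by rwa [uIcc_of_le (ht.1.trans ht.2)]))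
  rw [hmφ t ht, Pi.add_apply, Pi.zero_apply, zero_add]
  exact ((ContinuousLinearMap.proj (R := ℝ) (φ := fun _ : Fin C => ℝ)
    c).intervalIntegral_comp_comm hφt).symm

/-- A solution of the greedy inclusion is at all times an exact filling, and its sum grows at the
rate `max_k f k (m k)`. -/
theorem SolvesInclusion.isFilling (hf : RateFamily f b act ℓ Λ) (hτ : 0 ≤ τ)
    (hm : SolvesInclusion (greedyField f) τ 0 m) :
    (∀ t ∈ Icc 0 τ, IsFilling f b act 0 (m t)) ∧
      IntervalIntegrable (fun t => ⨆ k, f k (m t k)) volume 0 τ ∧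
      ∀ t ∈ Icc 0 τ, ∑ c, m t c = ∫ s in (0 : ℝ)..t, ⨆ k, f k (m s k) := by
  obtain ⟨φ, hφ, hmφ, hF⟩ := hm.exists_coord
  have hm0 : ∀ c, m 0 c = 0 := fun c => by simp [hmφ 0 ⟨le_rfl, hτ⟩ c]
  have hcont : ∀ c, ContinuousOn (fun t => m t c) (Icc 0 τ) := fun c => by
    refine ContinuousOn.congr ?_ fun t ht => hmφ t ht c
    have := intervalIntegral.continuousOn_primitive_interval
      (μ := volume) (f := fun s => φ s c) (a := 0) (b := τ) ?_
    · rwa [uIcc_of_le hτ] at this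
    · rw [uIcc_of_le hτ]
      exact (intervalIntegrable_iff_integrableOn_Icc_of_le hτ).1 (hφ c)
  have hint : ∀ c, ∀ s ∈ Icc 0 τ, ∀ t ∈ Icc 0 τ,
      IntervalIntegrable (fun s => φ s c) volume s t := fun c s hs t ht =>
    (hφ c).mono_set (by rw [uIcc_of_le hτ]; exact uIcc_subset_Icc hs ht)
  have hsub : ∀ c, ∀ s ∈ Icc 0 τ, ∀ t ∈ Icc 0 τ, m t c - m s c = ∫ u in s..t, φ u c := by
    intro c s hs t ht
    rw [hmφ s hs, hmφ t ht, intervalIntegral.integral_interval_sub_left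
      (hint c _ ⟨le_rfl, hτ⟩ _ ht) (hint c _ ⟨le_rfl, hτ⟩ _ hs)]
  -- The level `b c` is a barrier: above it `f c` is nonpositive, hence so is the velocity in
  -- direction `c`.
  have hle : ∀ c, ∀ t ∈ Icc 0 τ, m t c ≤ b c := by
    intro c t ht
    refine sub_nonpos.1 (nonpos_of_barrier (E := fun t => m t c - b c) (hφ c)
      (fun s hs => ?_) ?_ ?_ t ht)
    · rw [hmφ s hs c, hm0 c]; ring
    · rw [hm0 c]; linarith [hf.nonneg c]
    · filter_upwards [hF] with s hs hpos
      exact nonpos_of_mem_greedyField hs (hf.apply_nonpos (by linarith))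
  have hφ0 : ∀ c, ∀ᵐ t ∂(volume.restrict (Icc 0 τ)), 0 ≤ φ t c := by
    intro c
    filter_upwards [hF, ae_restrict_mem measurableSet_Icc] with t ht htm
    exact nonneg_of_mem_greedyField ht (hf.apply_nonneg (hle c t htm))
  have hmono : ∀ c, ∀ s ∈ Icc 0 τ, ∀ t ∈ Icc 0 τ, s ≤ t → m s c ≤ m t c := by
    intro c s hs t ht hst
    rw [← sub_nonneg, hsub c s hs t ht]
    refine intervalIntegral.integral_nonneg_of_ae_restrict hst ?_
    exact ae_restrict_of_ae_restrict_of_subset (Icc_subset_Icc hs.1 ht.2) (hφ0 c)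
  have hnonneg : ∀ c, ∀ t ∈ Icc 0 τ, 0 ≤ m t c := fun c t ht =>
    (hm0 c).symm.le.trans (hmono c 0 ⟨le_rfl, hτ⟩ t ht ht.1)
  -- If `k` strictly beats `c` at time `t`, go back to the last time `u` when it did not. Since then
  -- `m c` has been frozen while `f k (m k)` could only decrease, so `k` does not beat `c` at `t`
  -- either. If there is no such `u`, then `m c` has stayed at zero.
  have hmax : ∀ c, ∀ t ∈ Icc 0 τ, 0 < m t c → ∀ k, f k (m t k) ≤ f c (m t c) := by
    intro c t ht hpos k
    by_contra! hlt
    have hst : Icc 0 t ⊆ Icc 0 τ := Icc_subset_Icc_right ht.2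
    have hcl : IsClosed (Icc 0 t ∩ (fun s => f k (m s k) - f c (m s c)) ⁻¹' Iic 0) :=
      ContinuousOn.preimage_isClosed_of_isClosed
        (((hf.continuous k).comp_continuousOn ((hcont k).mono hst)).sub
          ((hf.continuous c).comp_continuousOn ((hcont c).mono hst))) isClosed_Icc isClosed_Iic
    have key : ∀ u ∈ Icc 0 t, (∀ s ∈ Ioc u t, f c (m s c) < f k (m s k)) → m t c = m u c := by
      intro u hu hs
      rw [← sub_eq_zero, hsub c u (hst hu) t ht]
      refine intervalIntegral.integral_zero_ae ?_
      have h3 := (ae_restrict_iff' measurableSet_Icc).1 hF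
      filter_upwards [h3] with s hsF hsm
      rw [uIoc_of_le hu.2] at hsm
      exact eq_zero_of_mem_greedyField
        (hsF ⟨hu.1.trans hsm.1.le, hsm.2.trans ht.2⟩) (hs s hsm)
    rcases (Icc 0 t ∩ (fun s => f k (m s k) - f c (m s c)) ⁻¹' Iic 0).eq_empty_or_nonempty
      with hemp | hne
    · have := key 0 ⟨le_rfl, ht.1⟩ fun s hs => by
        by_contra! hle'
        exact hemp.subset ⟨⟨hs.1.le, hs.2⟩, by simpa using hle'⟩
      rw [hm0] at this
      exact hpos.ne' this
    · obtain ⟨u, ⟨hu, huE⟩, hgr⟩ :=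
        (isCompact_Icc.of_isClosed_subset hcl inter_subset_left).exists_isGreatest hne
      have h1 := key u hu fun s hs => by
        by_contra! hle'
        exact absurd (hgr ⟨⟨hu.1.trans hs.1.le, hs.2⟩, by simpa using hle'⟩) (not_le.2 hs.1)
      have h2 : f k (m u k) ≤ f c (m u c) := by simpa using huE
      rw [← h1] at h2
      have h3 := hf.antitone k (hmono k u (hst hu) t ht hu.2)
      linarith
  have hact : ∀ c, ∀ t ∈ Icc 0 τ, 0 < m t c → act c := by
    intro c t ht hpos
    by_contra hc
    have h0 : m t c ≤ 0 := by
      rw [hmφ t ht c, intervalIntegral.integral_of_le ht.1]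
      refine integral_nonpos_of_ae (ae_restrict_of_ae_restrict_of_subset
        (Ioc_subset_Icc_self.trans (Icc_subset_Icc_right ht.2)) ?_)
      filter_upwards [hF] with s hs
      exact nonpos_of_mem_greedyField hs (hf.inactive c hc _).le
    linarith
  have hae : ∀ᵐ t ∂(volume.restrict (Icc 0 τ)), ∑ c, φ t c = ⨆ k, f k (m t k) := by
    filter_upwards [hF] with t ht using sum_eq_of_mem_greedyField ht
  have hsumint : IntervalIntegrable (fun t => ∑ c, φ t c) volume 0 τ :=
    (IntervalIntegrable.sum Finset.univ fun c _ => hφ c).congr fun t _ => by simp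
  refine ⟨fun t ht => ⟨fun c => hnonneg c t ht, fun c => hle c t ht, fun c => hact c t ht,
    fun c hc k => by simpa using hmax c t ht hc k⟩, ?_, fun t ht => ?_⟩
  · refine hsumint.congr_ae ?_
    rw [uIoc_of_le hτ]
    exact ae_restrict_of_ae_restrict_of_subset Ioc_subset_Icc_self hae
  · simp_rw [hmφ t ht]
    rw [← intervalIntegral.integral_finsetSum
      fun c _ => hint c _ ⟨le_rfl, hτ⟩ _ ht]
    refine intervalIntegral.integral_congr_ae ?_
    rw [← ae_restrict_iff' measurableSet_uIoc, uIoc_of_le ht.1]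
    exact ae_restrict_of_ae_restrict_of_subset
      (Ioc_subset_Icc_self.trans (Icc_subset_Icc_right ht.2)) hae

/-- Zero is a barrier for the difference of the totals: whenever it is positive, the solution with
the larger total has the smaller rate. -/
theorem SolvesInclusion.sum_le_sum [Nonempty (Fin C)] (hf : RateFamily f b act ℓ Λ)
    (hm : SolvesInclusion (greedyField f) τ 0 m) (hm' : SolvesInclusion (greedyField f) τ 0 m')
    {t : ℝ} (ht : t ∈ Icc 0 τ) : ∑ c, m t c ≤ ∑ c, m' t c := by
  obtain ⟨h1, h2, h3⟩ := hm.isFilling hf (ht.1.trans ht.2)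
  obtain ⟨h1', h2', h3'⟩ := hm'.isFilling hf (ht.1.trans ht.2)
  have h0 : (0 : ℝ) ∈ Icc 0 τ := ⟨le_rfl, ht.1.trans ht.2⟩
  refine sub_nonpos.1 (nonpos_of_barrier (E := fun t => ∑ c, m t c - ∑ c, m' t c) (h2.sub h2')
    (fun s hs => ?_) ?_ ?_ t ht)
  · have hi := h2.mono_set (uIcc_subset_uIcc_left (by rwa [uIcc_of_le (hs.1.trans hs.2)]))
    have hi' := h2'.mono_set (uIcc_subset_uIcc_left (by rwa [uIcc_of_le (hs.1.trans hs.2)]))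
    rw [intervalIntegral.integral_sub hi hi', h3 s hs, h3' s hs, h3 0 h0, h3' 0 h0]
    simp
  · simp [h3 0 h0, h3' 0 h0]
  · filter_upwards [ae_restrict_mem measurableSet_Icc] with s hs hpos
    refine sub_nonpos.2 ?_
    refine IsFilling.iSup_le_iSup (θ := 0) hf (by simpa using h1 s hs) (by simpa using h1' s hs)
      le_rfl ?_
    simpa using hpos

theorem SolvesInclusion.eqOn [Nonempty (Fin C)] (hf : RateFamily f b act ℓ Λ)
    (hm : SolvesInclusion (greedyField f) τ 0 m) (hm' : SolvesInclusion (greedyField f) τ 0 m') :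
    EqOn m m' (Icc 0 τ) := by
  intro t ht
  have hs := le_antisymm (hm.sum_le_sum hf hm' ht) (hm'.sum_le_sum hf hm ht)
  funext c
  have := IsFilling.abs_sub_le (θ := 0) hf (by simpa using (hm.isFilling hf (ht.1.trans ht.2)).1 t ht)
    (by simpa using (hm'.isFilling hf (ht.1.trans ht.2)).1 t ht) le_rfl c
  rw [hs] at this
  simpa [sub_eq_zero] using this

end Solution

/-! ### Existence of solutions of the greedy inclusion -/

section Level

variable {ι : Type*} {f : ι → ℝ → ℝ} {b : ι → ℝ} {act : ι → Prop} {ℓ Λ : ℝ}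

/-- The `x` provided is the amount to which class `c` is filled when every class is filled until its
rate has dropped to the common level `g`. -/
theorem RateFamily.exists_level (hf : RateFamily f b act ℓ Λ) (c : ι) {g : ℝ} (hg : 0 ≤ g) :
    ∃ x, 0 ≤ x ∧ x ≤ b c ∧ (0 < x → act c ∧ g ≤ f c x) ∧ (act c → x < b c → f c x ≤ g) := by
  by_cases hc : act c
  swap
  · exact ⟨0, le_rfl, hf.nonneg c, fun h => absurd h (lt_irrefl _), fun h => absurd h hc⟩
  rcases le_or_gt (f c 0) g with h | h
  · exact ⟨0, le_rfl, hf.nonneg c, fun h => absurd h (lt_irrefl _), fun _ _ => h⟩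
  · obtain ⟨x, hx, hxg⟩ := intermediate_value_Icc' (hf.nonneg c) (hf.continuous c).continuousOn
      (show g ∈ Icc (f c (b c)) (f c 0) from ⟨by rwa [hf.apply_eq_zero], h.le⟩)
    exact ⟨x, hx.1, hx.2, fun _ => ⟨hc, hxg.ge⟩, fun _ _ => hxg.le⟩

open Classical in
/-- There are exact fillings of every total size up to the total capacity of the active indices. -/
theorem RateFamily.exists_isFilling [Fintype ι] (hf : RateFamily f b act ℓ Λ) {s : ℝ}
    (hs : s ∈ Icc 0 (∑ c, if act c then b c else 0)) :
    ∃ x, IsFilling f b act 0 x ∧ ∑ c, x c = s := by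
  have hex : ∀ c, ∀ g : Ici (0 : ℝ), ∃ x, 0 ≤ x ∧ x ≤ b c ∧ (0 < x → act c ∧ g ≤ f c x) ∧
      (act c → x < b c → f c x ≤ g) := fun c g => hf.exists_level c g.2
  choose w hw0 hwb hwg hwl using hex
  have hzero : ∀ c, ¬ act c → ∀ g, w c g = 0 := fun c hc g =>
    le_antisymm (not_lt.1 fun h => hc (hwg c g h).1) (hw0 c g)
  -- The lower slope `ℓ` makes the amount a Lipschitz function of the level. Level 0 fills all
  -- active capacities and level 1 fills nothing, so intermediate levels realize every total.
  have hlip : ∀ c, ∀ g g' : Ici (0 : ℝ), g ≤ g' →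
      w c g' ≤ w c g ∧ ℓ * (w c g - w c g') ≤ g' - g := by
    intro c g g' hgg
    have hgg' : (g : ℝ) ≤ g' := hgg
    by_cases hc : act c
    swap
    · simp [hzero c hc, hgg']
    rcases lt_trichotomy (w c g) (w c g') with h | h | h
    · have h1 := (hwg c g' ((hw0 c g).trans_lt h)).2
      have h2 := hwl c g hc (h.trans_le (hwb c g'))
      have h3 := hf.lower c hc _ _ (hw0 c g) h.le (hwb c g')
      have h4 := mul_pos hf.pos (sub_pos.2 h)
      linarith
    · simp [h, hgg']
    · have h1 := (hwg c g ((hw0 c g').trans_lt h)).2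
      have h2 := hwl c g' hc (h.trans_le (hwb c g))
      have h3 := hf.lower c hc _ _ (hw0 c g') h.le (hwb c g)
      exact ⟨h.le, by linarith⟩
  have hcont : ∀ c, Continuous (w c) := by
    intro c
    refine (LipschitzWith.of_le_add_mul (1 / ℓ).toNNReal fun g g' => ?_).continuous
    rw [Real.coe_toNNReal _ (one_div_pos.2 hf.pos).le, Subtype.dist_eq, Real.dist_eq, div_mul_eq_mul_div, one_mul]
    have hℓ := hf.pos
    rw [← sub_le_iff_le_add', le_div_iff₀ hf.pos, mul_comm]
    rcases le_total g g' with h | h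
    · rw [abs_sub_comm]
      exact (hlip c g g' h).2.trans (le_abs_self _)
    · exact (mul_nonpos_of_nonneg_of_nonpos hℓ.le (by linarith [(hlip c g' g h).1])).trans
        (abs_nonneg _)
  have h0 : ∑ c, w c ⟨0, self_mem_Ici⟩ = ∑ c, if act c then b c else 0 := by
    refine Finset.sum_congr rfl fun c _ => ?_
    split_ifs with hc
    · refine le_antisymm (hwb c _) (not_lt.1 fun h => ?_)
      have h1 := hwl c _ hc h
      have h2 := hf.lower c hc _ _ (hw0 c _) h.le le_rfl
      rw [hf.apply_eq_zero] at h2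
      have h4 := mul_pos hf.pos (sub_pos.2 h)
      linarith
    · exact hzero c hc _
  have h1 : ∑ c, w c ⟨1, mem_Ici.2 zero_le_one⟩ = 0 := by
    refine Finset.sum_eq_zero fun c _ => le_antisymm (not_lt.1 fun h => ?_) (hw0 c _)
    obtain ⟨hc, h1⟩ := hwg c _ h
    have h2 := hf.lower c hc 0 _ le_rfl h.le (hwb c _)
    have h3 := mul_pos hf.pos h
    have h4 := hf.le_one c
    linarith
  have hpre : PreconnectedSpace (Ici (0 : ℝ)) :=
    isPreconnected_iff_preconnectedSpace.1 isPreconnected_Ici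
  obtain ⟨g, hg⟩ := mem_range_of_exists_le_of_exists_ge (f := fun g => ∑ c, w c g) (c := s)
    (continuous_finsetSum _ fun c _ => hcont c) ⟨_, h1.le.trans hs.1⟩ ⟨_, hs.2.trans h0.ge⟩
  refine ⟨fun c => w c g, ⟨fun c => hw0 c g, fun c => hwb c g, fun c hc => (hwg c g hc).1,
    fun c hc k => ?_⟩, hg⟩
  rw [add_zero]
  by_cases hk : act k
  · rcases (hwb k g).lt_or_eq with h | h
    · exact (hwl k g hk h).trans (hwg c g hc).2
    · rw [h, hf.apply_eq_zero]; exact hf.apply_nonneg (hwb c g)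
  · rw [hf.inactive k hk]; exact hf.apply_nonneg (hwb c g)

/-- One coordinate in the wrong order would put all coordinates weakly in that order, contradicting
the order of the totals. -/
theorem IsFilling.le_of_sum_le [Fintype ι] {x y : ι → ℝ} (hf : RateFamily f b act ℓ Λ)
    (hx : IsFilling f b act 0 x) (hy : IsFilling f b act 0 y) (h : ∑ c, x c ≤ ∑ c, y c) (k : ι) :
    x k ≤ y k := by
  by_contra! hk
  refine absurd (Finset.sum_lt_sum (fun c _ => ?_) ⟨k, Finset.mem_univ k, hk⟩) (not_lt.2 h)
  simpa using IsFilling.le_add_of_lt (θ := 0) hf (by simpa using hx) (by simpa using hy) le_rfl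
    (by simpa using hk) c

open Classical in
/-- The exact fillings form a curve parametrized by the total size. -/
theorem RateFamily.exists_curve [Fintype ι] [Nonempty ι] (hf : RateFamily f b act ℓ Λ) :
    ∃ (B : ℝ) (w : ℝ → ι → ℝ), 0 ≤ B ∧ (∀ s, IsFilling f b act 0 (w s)) ∧
      (∀ s ∈ Icc 0 B, ∑ c, w s c = s) ∧ (∀ s, B ≤ s → ⨆ k, f k (w s k) = 0) ∧
      LipschitzWith Λ.toNNReal fun s => ⨆ k, f k (w s k) := by
  set B := ∑ c, if act c then b c else 0 with hBdef
  have hB : 0 ≤ B := Finset.sum_nonneg fun c _ => by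
    split_ifs
    · exact hf.nonneg c
    · exact le_rfl
  choose w hw hws using fun s : Icc 0 B => hf.exists_isFilling s.2
  have hpr : ∀ s, ∑ c, w (projIcc 0 B hB s) c = projIcc 0 B hB s := fun s => hws _
  -- Clamping the total to `[0, B]` defines the curve on all of `ℝ`, so that the scalar field is
  -- globally Lipschitz and vanishes beyond `B`.
  refine ⟨B, fun s => w (projIcc 0 B hB s), hB, fun s => hw _, fun s hs => ?_, fun s hs => ?_, ?_⟩
  · rw [hpr, projIcc_of_mem hB hs]
  · beta_reduce
    rw [projIcc_of_right_le hB hs]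
    have hle : ∀ k, (if act k then b k else 0) ≤ w ⟨B, right_mem_Icc.2 hB⟩ k := by
      have h1 : ∀ k ∈ Finset.univ, w ⟨B, right_mem_Icc.2 hB⟩ k ≤ if act k then b k else 0 := by
        intro k _
        split_ifs with hk
        · exact (hw _).le k
        · exact not_lt.1 fun h => hk ((hw _).active k h)
      intro k
      exact ((Finset.sum_eq_sum_iff_of_le h1).1 ((hws _).trans hBdef) k (Finset.mem_univ k)).ge
    have hz : ∀ k, f k (w ⟨B, right_mem_Icc.2 hB⟩ k) = 0 := by
      intro k
      by_cases hk : act k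
      · have := hle k
        rw [if_pos hk] at this
        rw [le_antisymm ((hw _).le k) this, hf.apply_eq_zero]
      · exact hf.inactive k hk _
    simp [hz]
  · have hmono : ∀ s t, s ≤ t → ∀ k, w (projIcc 0 B hB s) k ≤ w (projIcc 0 B hB t) k := by
      intro s t hst k
      refine (hw _).le_of_sum_le hf (hw _) ?_ k
      rw [hpr, hpr]
      exact monotone_projIcc hB hst
    have key : ∀ s t, s ≤ t → ⨆ k, f k (w (projIcc 0 B hB s) k) ≤
        (⨆ k, f k (w (projIcc 0 B hB t) k)) + Λ * (t - s) := by
      intro s t hst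
      refine ciSup_le fun k => ?_
      have h1 := hf.upper k _ _ ((hw (projIcc 0 B hB s)).nonneg k) (hmono s t hst k) ((hw _).le k)
      have h2 := apply_le_iSup f (w (projIcc 0 B hB t)) k
      have h3 : w (projIcc 0 B hB t) k - w (projIcc 0 B hB s) k ≤ t - s := by
        have h4 := Finset.single_le_sum
          (f := fun k => w (projIcc 0 B hB t) k - w (projIcc 0 B hB s) k) (s := Finset.univ)
          (fun k _ => sub_nonneg.2 (hmono s t hst k)) (Finset.mem_univ k)
        rw [Finset.sum_sub_distrib, hpr, hpr] at h4
        have h5 := abs_projIcc_sub_projIcc hB (c := t) (d := s)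
        rw [abs_of_nonneg (sub_nonneg.2 hst)] at h5
        exact h4.trans ((le_abs_self _).trans h5)
      have h6 := mul_le_mul_of_nonneg_left h3 hf.slope_nonneg
      linarith
    have anti : ∀ s t, s ≤ t → ⨆ k, f k (w (projIcc 0 B hB t) k) ≤
        ⨆ k, f k (w (projIcc 0 B hB s) k) := by
      intro s t hst
      refine ciSup_le fun k => ?_
      exact (hf.antitone k (hmono s t hst k)).trans (apply_le_iSup f _ k)
    refine LipschitzWith.of_le_add_mul _ fun s t => ?_
    rw [Real.coe_toNNReal _ hf.slope_nonneg, Real.dist_eq]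
    rcases le_total s t with h | h
    · rw [abs_sub_comm, abs_of_nonneg (sub_nonneg.2 h)]
      exact key s t h
    · have := mul_nonneg hf.slope_nonneg (abs_nonneg (s - t))
      linarith [anti t s h]

end Level

theorem exists_solvesInclusion {C : ℕ} [Nonempty (Fin C)] {f : Fin C → ℝ → ℝ} {b : Fin C → ℝ}
    {act : Fin C → Prop} {ℓ Λ τ : ℝ} (hf : RateFamily f b act ℓ Λ) (hτ : 0 ≤ τ) :
    ∃ m, SolvesInclusion (greedyField f) τ 0 m := by
  obtain ⟨B, w, hB, hw, hws, hwB, hlip⟩ := hf.exists_curve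
  set G : ℝ → ℝ := fun s => ⨆ k, f k (w s k) with hG
  have hG0 : ∀ s, 0 ≤ G s := fun s => (hw s).iSup_nonneg hf
  have hG1 : ∀ s, G s ≤ 1 := fun s => (hw s).iSup_le_one hf
  -- The speed is at most 1, so a ball of radius `τ` confines the solution on the whole interval.
  have hpl : IsPicardLindelof (fun _ => G) (⟨0, left_mem_Icc.2 hτ⟩ : Icc 0 τ) 0 τ.toNNReal 0 1
      Λ.toNNReal := by
    refine ⟨fun _ _ => hlip.lipschitzOnWith, fun _ _ => continuousOn_const, fun _ _ s _ => ?_, ?_⟩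
    · rw [Real.norm_eq_abs, abs_of_nonneg (hG0 s)]
      exact hG1 s
    · simp [hτ]
  obtain ⟨σ, hσ0, hσ⟩ := hpl.exists_eq_forall_mem_Icc_hasDerivWithinAt₀
  have hσ0 : σ 0 = 0 := hσ0
  have hσc : ContinuousOn σ (Icc 0 τ) := fun t ht => (hσ t ht).continuousWithinAt
  have hσd : ∀ t ∈ Ioo 0 τ, HasDerivAt σ (G (σ t)) t := fun t ht =>
    (hσ t (Ioo_subset_Icc_self ht)).hasDerivAt (Icc_mem_nhds ht.1 ht.2)
  have hσm : MonotoneOn σ (Icc 0 τ) := by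
    refine monotoneOn_of_deriv_nonneg (convex_Icc 0 τ) hσc ?_ ?_
    · rw [interior_Icc]
      exact fun t ht => (hσd t ht).differentiableAt.differentiableWithinAt
    · rw [interior_Icc]
      exact fun t ht => (hσd t ht).deriv ▸ hG0 _
  have hσlip : LipschitzOnWith 1 σ (Icc 0 τ) := by
    refine (convex_Icc 0 τ).lipschitzOnWith_of_nnnorm_hasDerivWithin_le hσ fun t _ => ?_
    rw [← NNReal.coe_le_coe, coe_nnnorm, Real.norm_eq_abs, abs_of_nonneg (hG0 _)]
    exact hG1 _
  have hGσ : ContinuousOn (fun t => G (σ t)) (Icc 0 τ) := hlip.continuous.comp_continuousOn hσc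
  have hGint : IntervalIntegrable (fun t => G (σ t)) volume 0 τ :=
    ContinuousOn.intervalIntegrable (by rwa [uIcc_of_le hτ])
  have hσB : ∀ t ∈ Icc 0 τ, σ t ∈ Icc 0 B := by
    intro t ht
    refine ⟨hσ0 ▸ hσm (left_mem_Icc.2 hτ) ht ht.1, sub_nonpos.1 ?_⟩
    refine nonpos_of_barrier (E := fun t => σ t - B) hGint (fun s hs => ?_) ?_ ?_ t ht
    · rw [intervalIntegral.integral_eq_sub_of_hasDerivAt_of_le hs.1
        (hσc.mono (Icc_subset_Icc_right hs.2))
        (fun u hu => hσd u ⟨hu.1, hu.2.trans_le hs.2⟩)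
        (hGint.mono_set (uIcc_subset_uIcc_left (by rwa [uIcc_of_le hτ])))]
      ring
    · simpa [hσ0] using hB
    -- Beyond `B` the rate vanishes, so the total cannot leave the range where the curve is
    -- parametrized by its total.
    · exact Filter.Eventually.of_forall fun s hs => (hwB _ (by linarith)).le
  have hsum : ∀ t ∈ Icc 0 τ, ∑ c, w (σ t) c = σ t := fun t ht => hws _ (hσB t ht)
  have hmono : ∀ c, MonotoneOn (fun t => w (σ t) c) (Icc 0 τ) := by
    intro c s hs t ht hst
    refine (hw _).le_of_sum_le hf (hw _) ?_ c
    rw [hsum s hs, hsum t ht]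
    exact hσm hs ht hst
  have hmlip : ∀ c, LipschitzOnWith 1 (fun t => w (σ t) c) (Icc 0 τ) := by
    intro c
    refine LipschitzOnWith.of_dist_le_mul fun s hs t ht => ?_
    have h1 := IsFilling.abs_sub_le (θ := 0) hf (by simpa using hw (σ s))
      (by simpa using hw (σ t)) le_rfl c
    rw [hsum s hs, hsum t ht, mul_zero, add_zero] at h1
    have h2 := hσlip.dist_le_mul s hs t ht
    rw [Real.dist_eq] at h2 ⊢
    exact h1.trans h2
  have hac : ∀ c, ∀ t ∈ Icc 0 τ,
      AbsolutelyContinuousOnInterval (fun t => w (σ t) c) 0 t := fun c t ht =>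
    LipschitzOnWith.absolutelyContinuousOnInterval (K := 1) (by
      rw [uIcc_of_le ht.1]; exact (hmlip c).mono (Icc_subset_Icc_right ht.2))
  have hw0 : ∀ c, w 0 c = 0 := fun c =>
    (Finset.sum_eq_zero_iff_of_nonneg fun c _ => (hw 0).nonneg c).1
      (hws 0 (left_mem_Icc.2 hB)) c (Finset.mem_univ c)
  set φ : ℝ → Fin C → ℝ := fun t c => deriv (fun t => w (σ t) c) t with hφ
  have hφint : ∀ t ∈ Icc 0 τ, IntervalIntegrable φ volume 0 t := fun t ht =>
    ⟨Integrable.of_eval fun c => ((hac c t ht).intervalIntegrable_deriv).1,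
      Integrable.of_eval fun c => ((hac c t ht).intervalIntegrable_deriv).2⟩
  refine ⟨fun t => w (σ t), φ, hφint τ (right_mem_Icc.2 hτ), fun t ht => ?_, ?_⟩
  · funext c
    have h1 := (ContinuousLinearMap.proj (R := ℝ) (φ := fun _ : Fin C => ℝ)
      c).intervalIntegral_comp_comm (hφint t ht)
    have h2 := (hac c t ht).integral_deriv_eq_sub
    rw [zero_add]
    refine Eq.trans ?_ h1
    refine Eq.trans ?_ h2.symm
    simp [hσ0, hw0]
  · have hdiff : ∀ᵐ t, ∀ c, t ∈ Icc 0 τ → DifferentiableAt ℝ (fun t => w (σ t) c) t := by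
      rw [ae_all_iff]
      intro c
      have := (hac c τ (right_mem_Icc.2 hτ)).ae_differentiableAt
      rwa [uIcc_of_le hτ] at this
    rw [← restrict_Ioo_eq_restrict_Icc, ae_restrict_iff' measurableSet_Ioo]
    filter_upwards [hdiff] with t hd ht
    have hnhds : Icc 0 τ ∈ nhds t := Icc_mem_nhds ht.1 ht.2
    have hd : ∀ c, DifferentiableAt ℝ (fun t => w (σ t) c) t := fun c =>
      hd c (Ioo_subset_Icc_self ht)
    refine mem_greedyField (fun c => ?_) (fun c hc k => ?_) ?_
    · have := (hmono c).derivWithin_nonneg (x := t)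
      rwa [derivWithin_of_mem_nhds hnhds] at this
    -- A coordinate equal to zero is at its global minimum, so its derivative vanishes there. A
    -- nonzero velocity therefore occurs only in a nonempty class, which is a maximizer because `w
    -- (σ t)` is an exact filling.
    · have hpos : 0 < w (σ t) c := by
        refine lt_of_le_of_ne ((hw _).nonneg c) fun h0 => hc ?_
        refine IsLocalMin.deriv_eq_zero (Filter.Eventually.of_forall fun s => ?_)
        simpa [← h0] using (hw (σ s)).nonneg c
      simpa using (hw _).le_add c hpos k
    · have h1 : HasDerivAt (fun t => ∑ c, w (σ t) c) (∑ c, φ t c) t :=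
        HasDerivAt.fun_sum fun c _ => (hd c).hasDerivAt
      have h2 : HasDerivAt (fun t => ∑ c, w (σ t) c) (G (σ t)) t :=
        (hσd t ht).congr_of_eventuallyEq (Filter.eventuallyEq_of_mem hnhds hsum)
      exact h1.unique h2

/-! ### The fluid rates and the scores of Balance -/

theorem exists_pos_le_of_finite {ι : Type*} [Finite ι] (p : ι → Prop) (g : ι → ℝ)
    (h : ∀ i, p i → 0 < g i) : ∃ r > 0, ∀ i, p i → r ≤ g i := by
  rcases isEmpty_or_nonempty {i // p i} with he | he
  · exact ⟨1, one_pos, fun i hi => (he.false ⟨i, hi⟩).elim⟩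
  · obtain ⟨i₀, hi₀⟩ := Finite.exists_min fun i : {i // p i} => g i
    exact ⟨g i₀, h i₀ i₀.2, fun i hi => hi₀ ⟨i, hi⟩⟩

theorem sum_toReal_eq_one {β : Type*} [Fintype β] (ν : PMF β) : ∑ d, (ν d).toReal = 1 := by
  rw [← ENNReal.toReal_sum fun d _ => ν.apply_ne_top d, ← tsum_fintype (L := .unconditional _),
    ν.tsum_coe, ENNReal.toReal_one]

theorem exp_sub_exp_le {u v : ℝ} (huv : u ≤ v) (hv : v ≤ 0) : Real.exp v - Real.exp u ≤ v - u := by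
  have h1 := Real.add_one_le_exp (u - v)
  have h2 : Real.exp u = Real.exp v * Real.exp (u - v) := by rw [← Real.exp_add]; ring_nf
  have h3 := Real.exp_le_one_iff.2 hv
  have h4 := Real.exp_pos v
  have h5 := Real.exp_le_one_iff.2 (sub_nonpos.2 huv)
  rw [h2]
  nlinarith

theorem le_exp_sub_exp (u v : ℝ) : Real.exp u * (v - u) ≤ Real.exp v - Real.exp u := by
  have h1 := Real.add_one_le_exp (v - u)
  have h2 : Real.exp v = Real.exp u * Real.exp (v - u) := by rw [← Real.exp_add]; ring_nf
  have h4 := Real.exp_pos u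
  rw [h2]
  nlinarith

section Rates

variable {C D : ℕ} {a : Fin C → Fin D → ℝ} {ν : PMF (Fin D)} {A : ℝ}

theorem fluidRate_sub (c : Fin C) (β x y : ℝ) :
    fluidRate a ν c β x - fluidRate a ν c β y =
      ∑ d, (Real.exp (-(a c d * (β - y))) - Real.exp (-(a c d * (β - x)))) * (ν d).toReal := by
  rw [fluidRate, fluidRate, ← Finset.sum_sub_distrib]
  exact Finset.sum_congr rfl fun d _ => by ring

/-- The mean of the row of the class `c`. -/
def rowMean (a : Fin C → Fin D → ℝ) (ν : PMF (Fin D)) (c : Fin C) : ℝ := ∑ d, a c d * (ν d).toReal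

theorem eq_zero_of_rowMean_nonpos (ha : ∀ c d, 0 ≤ a c d) {c : Fin C} (h : ¬ 0 < rowMean a ν c)
    (d : Fin D) : a c d = 0 ∨ (ν d).toReal = 0 := by
  have h0 : ∀ d ∈ Finset.univ, 0 ≤ a c d * (ν d).toReal := fun d _ =>
    mul_nonneg (ha c d) ENNReal.toReal_nonneg
  have := (Finset.sum_eq_zero_iff_of_nonneg h0).1
    (le_antisymm (not_lt.1 h) (Finset.sum_nonneg h0)) d (Finset.mem_univ d)
  exact mul_eq_zero.1 this

/-- The fluid rates form a rate family, with slope bounds that do not depend on the class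
proportions as long as these are bounded. -/
theorem exists_rateFamily (ha : ∀ c d, 0 ≤ a c d) (hA0 : 0 ≤ A) (hA : ∀ c d, a c d ≤ A) (β : ℝ) :
    ∃ ℓ, ∀ b : Fin C → ℝ, (∀ c, 0 ≤ b c) → (∀ c, b c ≤ β) →
      RateFamily (fun c => fluidRate a ν c (b c)) b (fun c => 0 < rowMean a ν c) ℓ A := by
  obtain ⟨r, hr, hrle⟩ := exists_pos_le_of_finite (fun c => 0 < rowMean a ν c)
    (fun c => rowMean a ν c) fun c hc => hc
  have hν : ∀ d, 0 ≤ (ν d).toReal := fun d => ENNReal.toReal_nonneg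
  -- Each exponential on the relevant range is at least `exp (-(A * β))`, and `r` is a lower bound
  -- for the positive row means.
  refine ⟨Real.exp (-(A * β)) * r, fun b hb hbβ => ⟨mul_pos (Real.exp_pos _) hr, hA0, hb,
    fun c => ?_, fun c => ?_, fun c => ?_, fun c hc x => ?_, fun c => ?_, fun c hc x y hx hxy hy => ?_,
    fun c x y hx hxy hy => ?_⟩⟩
  · unfold fluidRate
    fun_prop
  · intro x y hxy
    refine Finset.sum_le_sum fun d _ => mul_le_mul_of_nonneg_right ?_ (hν d)
    have := mul_le_mul_of_nonneg_left hxy (ha c d)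
    have := Real.exp_le_exp.2 (show -(a c d * (b c - x)) ≤ -(a c d * (b c - y)) by linarith)
    linarith
  · simp [fluidRate]
  · refine Finset.sum_eq_zero fun d _ => ?_
    rcases eq_zero_of_rowMean_nonpos ha hc d with h | h <;> simp [h]
  · rw [← sum_toReal_eq_one ν]
    refine Finset.sum_le_sum fun d _ => mul_le_of_le_one_left (hν d) ?_
    linarith [Real.exp_pos (-(a c d * (b c - 0)))]
  · rw [fluidRate_sub]
    calc Real.exp (-(A * β)) * r * (y - x)
        ≤ Real.exp (-(A * β)) * rowMean a ν c * (y - x) := by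
          have := hrle c hc
          have := sub_nonneg.2 hxy
          gcongr
      _ = ∑ d, Real.exp (-(A * β)) * (a c d * (y - x)) * (ν d).toReal := by
          rw [rowMean, Finset.mul_sum, Finset.sum_mul]
          exact Finset.sum_congr rfl fun d _ => by ring
      _ ≤ _ := by
          refine Finset.sum_le_sum fun d _ => mul_le_mul_of_nonneg_right ?_ (hν d)
          refine le_trans ?_ (le_exp_sub_exp _ _)
          have h1 : a c d * (b c - x) ≤ A * β :=
            (mul_le_mul_of_nonneg_left (show b c - x ≤ β by linarith [hbβ c]) (ha c d)).trans
              (mul_le_mul_of_nonneg_right (hA c d) ((hb c).trans (hbβ c)))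
          have h2 : -(a c d * (b c - y)) - -(a c d * (b c - x)) = a c d * (y - x) := by ring
          rw [h2]
          exact mul_le_mul_of_nonneg_right (Real.exp_le_exp.2 (by linarith))
            (mul_nonneg (ha c d) (sub_nonneg.2 hxy))
  · rw [fluidRate_sub]
    calc _ ≤ ∑ d, A * (y - x) * (ν d).toReal := by
          refine Finset.sum_le_sum fun d _ => mul_le_mul_of_nonneg_right ?_ (hν d)
          have h1 := mul_le_mul_of_nonneg_left hxy (ha c d)
          have h2 := mul_nonneg (ha c d) (sub_nonneg.2 hy)
          have h3 := mul_le_mul_of_nonneg_right (hA c d) (sub_nonneg.2 hxy)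
          have h4 := exp_sub_exp_le (u := -(a c d * (b c - x))) (v := -(a c d * (b c - y)))
            (by linarith) (by linarith)
          linarith
      _ = A * (y - x) := by rw [← Finset.mul_sum, sum_toReal_eq_one, mul_one]

/-- The probability that an arriving node has a neighbour in a set of `k` nodes of class `c`. -/
noncomputable def poolRate (N : ℕ) (a : Fin C → Fin D → ℝ) (ν : PMF (Fin D)) (c : Fin C) (k : ℕ) : ℝ :=
  ∑ d, (1 - (1 - a c d / N) ^ k) * (ν d).toReal

variable {N : ℕ}

theorem poolRate_mono (ha : ∀ c d, 0 ≤ a c d) (haN : ∀ c d, a c d ≤ N) (c : Fin C) :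
    Monotone (poolRate N a ν c) := by
  intro j k hjk
  refine Finset.sum_le_sum fun d _ => mul_le_mul_of_nonneg_right ?_ ENNReal.toReal_nonneg
  have h0 : 0 ≤ a c d / N := div_nonneg (ha c d) N.cast_nonneg
  have h1 : a c d / N ≤ 1 := div_le_one_of_le₀ (haN c d) N.cast_nonneg
  linarith [pow_le_pow_of_le_one (sub_nonneg.2 h1) (by linarith) hjk]

theorem poolRate_nonneg (ha : ∀ c d, 0 ≤ a c d) (haN : ∀ c d, a c d ≤ N) (c : Fin C) (k : ℕ) :
    0 ≤ poolRate N a ν c k := by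
  have := poolRate_mono (ν := ν) ha haN c (Nat.zero_le k)
  simpa [poolRate] using this

theorem poolRate_le_one (haN : ∀ c d, a c d ≤ N) (c : Fin C) (k : ℕ) :
    poolRate N a ν c k ≤ 1 := by
  rw [← sum_toReal_eq_one ν]
  refine Finset.sum_le_sum fun d _ => mul_le_of_le_one_left ENNReal.toReal_nonneg ?_
  have h1 : a c d / N ≤ 1 := div_le_one_of_le₀ (haN c d) N.cast_nonneg
  linarith [pow_nonneg (sub_nonneg.2 h1) k]

theorem rowMean_pos_of_poolRate_pos (ha : ∀ c d, 0 ≤ a c d) {c : Fin C} {k : ℕ}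
    (h : 0 < poolRate N a ν c k) : 0 < rowMean a ν c := by
  by_contra hc
  refine h.ne' (Finset.sum_eq_zero fun d _ => ?_)
  rcases eq_zero_of_rowMean_nonpos ha hc d with h | h <;> simp [h]

/-- Both quantities average `k`-th powers, of `1 - x` and of `exp (-x)` with `x = a c d / N`. The
bases lie in `[0, 1]` and differ by at most `x ^ 2`, so the powers differ by at most `k * x ^ 2`
with `k ≤ N`. -/
theorem abs_poolRate_sub_fluidRate_le (ha : ∀ c d, 0 ≤ a c d) (hA : ∀ c d, a c d ≤ A)
    (haN : ∀ c d, a c d ≤ N) {c : Fin C} {k : ℕ} (hk : k ≤ N) {β x : ℝ} (hx : β - x = k / N) :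
    |poolRate N a ν c k - fluidRate a ν c β x| ≤ A ^ 2 / N := by
  have key : ∀ d, |(1 - a c d / N) ^ k - Real.exp (-(a c d * (β - x)))| ≤ A ^ 2 / N := by
    intro d
    rcases N.eq_zero_or_pos with hN | hN
    · subst hN
      have : k = 0 := by omega
      subst this
      simp [hx]
    have hN' : (0 : ℝ) < N := by exact_mod_cast hN
    have h0 : 0 ≤ a c d / N := div_nonneg (ha c d) N.cast_nonneg
    have h1 : a c d / N ≤ 1 := div_le_one_of_le₀ (haN c d) N.cast_nonneg
    have he : Real.exp (-(a c d * (β - x))) = Real.exp (-(a c d / N)) ^ k := by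
      rw [← Real.exp_nat_mul, hx]
      congr 1
      ring
    have h2 := abs_pow_sub_pow_le (1 - a c d / N) (Real.exp (-(a c d / N))) k
    have h3 : |1 - a c d / N - Real.exp (-(a c d / N))| ≤ (a c d / N) ^ 2 := by
      have := Real.abs_exp_sub_one_sub_id_le (x := -(a c d / N))
        (by rwa [abs_neg, abs_of_nonneg h0])
      rw [abs_sub_comm]
      convert this using 1
      · congr 1; ring
      · ring
    have h4 : max |1 - a c d / N| |Real.exp (-(a c d / N))| ^ (k - 1) ≤ 1 := by
      refine pow_le_one₀ (le_max_of_le_left (abs_nonneg _)) (max_le ?_ ?_)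
      · rw [abs_of_nonneg (by linarith)]; linarith
      · rw [abs_of_pos (Real.exp_pos _)]
        exact Real.exp_le_one_iff.2 (by linarith)
    rw [he]
    calc _ ≤ _ := h2
      _ ≤ (a c d / N) ^ 2 * N * 1 := by
          gcongr
      _ = a c d ^ 2 / N := by field_simp
      _ ≤ A ^ 2 / N := by
          have := hA c d
          have := ha c d
          gcongr
  rw [poolRate, fluidRate, ← Finset.sum_sub_distrib]
  refine (Finset.abs_sum_le_sum_abs _ _).trans ?_
  calc _ ≤ ∑ d, A ^ 2 / N * (ν d).toReal := by
        refine Finset.sum_le_sum fun d _ => ?_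
        rw [← sub_mul, abs_mul, abs_of_nonneg (ENNReal.toReal_nonneg (a := ν d))]
        refine mul_le_mul_of_nonneg_right ?_ ENNReal.toReal_nonneg
        have := key d
        rw [abs_sub_comm] at this
        rwa [sub_sub_sub_cancel_left]
    _ = A ^ 2 / N := by rw [← Finset.mul_sum, sum_toReal_eq_one, mul_one]

end Rates

/-! ### The law of one arrival -/

section Arrival

/-- Expand the product over all `n` of (weight of inclusion + weight of exclusion), with the
inclusion weight set to zero on `P`: precisely the subsets avoiding `P` survive. -/
theorem sum_randomSubset_of_disjoint {N : ℕ} (p : Fin N → unitInterval) (P : Fin N → Prop)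
    [DecidablePred P] :
    ∑ E, (if (E.filter P).Nonempty then 0 else randomSubset p E) =
      ∏ n ∈ Finset.univ.filter P, ENNReal.ofReal (1 - p n) := by
  have h1 : ∏ n ∈ Finset.univ.filter P, ENNReal.ofReal (1 - (p n : ℝ)) =
      ∏ n, ((if P n then 0 else ENNReal.ofReal (p n)) + ENNReal.ofReal (1 - (p n : ℝ))) := by
    rw [Finset.prod_filter]
    refine Finset.prod_congr rfl fun n _ => ?_
    split_ifs
    · rw [zero_add]
    · rw [← ENNReal.ofReal_add (p n).2.1 (sub_nonneg.2 (p n).2.2)]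
      simp
  rw [h1, Finset.prod_add, Finset.powerset_univ]
  refine Finset.sum_congr rfl fun E _ => ?_
  split_ifs with h
  · obtain ⟨n, hn⟩ := h
    rw [Finset.mem_filter] at hn
    rw [Finset.prod_eq_zero hn.1 (by simp [hn.2]), zero_mul]
  · rw [randomSubset, PMF.ofFintype_apply]
    congr 1
    refine Finset.prod_congr rfl fun n hn => ?_
    rw [if_neg fun hP => h ⟨n, Finset.mem_filter.2 ⟨hn, hP⟩⟩]

variable {N C D : ℕ} {a : Fin C → Fin D → ℝ} {ν : PMF (Fin D)} {cls : Fin N → Fin C}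
  {S : Finset (Fin N)} {c : Fin C}

theorem matchedSize_le_classSize (cls : Fin N → Fin C) (S : Finset (Fin N)) (c : Fin C) :
    matchedSize cls S c ≤ classSize cls c :=
  Finset.card_le_card (Finset.filter_subset_filter _ (Finset.subset_univ S))

theorem classSize_le (cls : Fin N → Fin C) (c : Fin C) : classSize cls c ≤ N :=
  (Finset.card_filter_le _ _).trans (by simp)

theorem card_unmatched (cls : Fin N → Fin C) (S : Finset (Fin N)) (c : Fin C) :
    (Finset.univ.filter fun n => n ∉ S ∧ cls n = c).card =
      classSize cls c - matchedSize cls S c := by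
  have h : (Finset.univ.filter fun n => n ∉ S ∧ cls n = c) =
      (Finset.univ.filter fun n => cls n = c) \ S.filter fun n => cls n = c := by
    ext n
    simp only [Finset.mem_filter, Finset.mem_univ, true_and, Finset.mem_sdiff]
    tauto
  rw [h, Finset.card_sdiff_of_subset (Finset.filter_subset_filter _ (Finset.subset_univ S))]
  rfl

theorem balanceScore_eq (S : Finset (Fin N)) (c : Fin C) :
    balanceScore a ν cls S c = poolRate N a ν c (classSize cls c - matchedSize cls S c) := rfl

theorem mem_support_arrival {S' : Finset (Fin N)} (h : S' ∈ (arrival a ν cls S c).support) :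
    S' = S ∨ ∃ n ∉ S, cls n = c ∧ S' = insert n S := by
  simp only [arrival, PMF.mem_support_bind_iff] at h
  obtain ⟨d, -, E, -, h⟩ := h
  split_ifs at h with hE
  · rw [PMF.mem_support_map_iff] at h
    obtain ⟨n, hn, rfl⟩ := h
    rw [PMF.mem_support_uniformOfFinset_iff, Finset.mem_filter] at hn
    exact Or.inr ⟨n, hn.2.1, hn.2.2, rfl⟩
  · exact Or.inl ((PMF.mem_support_pure_iff _ _).1 h)

/-- A match always inserts a node outside `S`, so the set is unchanged exactly when the arriving
node has no unmatched neighbour in the selected class. -/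
theorem arrival_apply_self (ha : ∀ c d, 0 ≤ a c d) (haN : ∀ c d, a c d ≤ N) :
    (arrival a ν cls S c S).toReal = 1 - balanceScore a ν cls S c := by
  have h1 : arrival a ν cls S c S = ∑ d, ν d * ENNReal.ofReal
      ((1 - a c d / N) ^ (classSize cls c - matchedSize cls S c)) := by
    rw [arrival, PMF.bind_apply, tsum_fintype]
    refine Finset.sum_congr rfl fun d _ => ?_
    congr 1
    have h0 : 0 ≤ a c d / N := div_nonneg (ha c d) N.cast_nonneg
    have h1 : a c d / N ≤ 1 := div_le_one_of_le₀ (haN c d) N.cast_nonneg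
    rw [PMF.bind_apply, tsum_fintype, ← card_unmatched, ENNReal.ofReal_pow (sub_nonneg.2 h1),
      ← Finset.prod_const]
    have h2 : ∏ _n ∈ Finset.univ.filter fun n => n ∉ S ∧ cls n = c,
        ENNReal.ofReal (1 - a c d / N) =
        ∏ n ∈ Finset.univ.filter fun n => n ∉ S ∧ cls n = c,
          ENNReal.ofReal (1 - (edgeProb N a (cls n) d : ℝ)) := by
      refine Finset.prod_congr rfl fun n hn => ?_
      rw [(Finset.mem_filter.1 hn).2.2, edgeProb, projIcc_of_mem zero_le_one ⟨h0, h1⟩]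
    rw [h2, ← sum_randomSubset_of_disjoint]
    refine Finset.sum_congr rfl fun E _ => ?_
    split_ifs with hE
    · refine mul_eq_zero.2 (Or.inr ?_)
      rw [← not_ne_iff, ← PMF.mem_support_iff, PMF.mem_support_map_iff]
      rintro ⟨n, hn, hnS⟩
      rw [PMF.mem_support_uniformOfFinset_iff, Finset.mem_filter] at hn
      exact hn.2.1 (hnS ▸ Finset.mem_insert_self n S)
    · rw [PMF.pure_apply_self, mul_one]
  have h2 : ∀ d, 0 ≤ 1 - a c d / N := fun d =>
    sub_nonneg.2 (div_le_one_of_le₀ (haN c d) N.cast_nonneg)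
  have h3 : 1 - balanceScore a ν cls S c = ∑ d, ((ν d).toReal -
      (1 - (1 - a c d / N) ^ (classSize cls c - matchedSize cls S c)) * (ν d).toReal) := by
    rw [Finset.sum_sub_distrib, sum_toReal_eq_one, balanceScore]
  rw [h1, h3,
    ENNReal.toReal_sum fun d _ => ENNReal.mul_ne_top (ν.apply_ne_top d) ENNReal.ofReal_ne_top]
  refine Finset.sum_congr rfl fun d _ => ?_
  rw [ENNReal.toReal_mul, ENNReal.toReal_ofReal (pow_nonneg (h2 d) _)]
  ring

/-- The expectation of a function that takes one value on `S` and another one on the sets that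
arise from `S` by matching a node. -/
theorem sum_arrival_mul (ha : ∀ c d, 0 ≤ a c d) (haN : ∀ c d, a c d ≤ N)
    (g : Finset (Fin N) → ℝ) (g₁ : ℝ) (hg : ∀ n ∉ S, cls n = c → g (insert n S) = g₁) :
    ∑ S', (arrival a ν cls S c S').toReal * g S' =
      (1 - balanceScore a ν cls S c) * g S + balanceScore a ν cls S c * g₁ := by
  have h1 : ∀ S', (arrival a ν cls S c S').toReal * g S' =
      (arrival a ν cls S c S').toReal * g₁ +
        if S' = S then (arrival a ν cls S c S').toReal * (g S - g₁) else 0 := by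
    intro S'
    split_ifs with h
    · rw [h]; ring
    · by_cases h0 : S' ∈ (arrival a ν cls S c).support
      · obtain h' | ⟨n, hn, hc, rfl⟩ := mem_support_arrival h0
        · exact absurd h' h
        · rw [hg n hn hc, add_zero]
      · rw [PMF.mem_support_iff, not_not] at h0
        simp [h0]
  simp_rw [h1]
  rw [Finset.sum_add_distrib, ← Finset.sum_mul, sum_toReal_eq_one, Finset.sum_ite_eq']
  simp only [Finset.mem_univ, if_true]
  rw [arrival_apply_self ha haN]
  ring

theorem balanceScore_pos_of_mem_support (ha : ∀ c d, 0 ≤ a c d) (haN : ∀ c d, a c d ≤ N)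
    {S' : Finset (Fin N)} (h : S' ∈ (arrival a ν cls S c).support) (hS : S' ≠ S) :
    0 < balanceScore a ν cls S c := by
  classical
  have h1 := sum_arrival_mul (ν := ν) (S := S) (c := c) (cls := cls) ha haN
    (fun S' => if S' = S then 0 else 1) 1 fun n hn _ => if_neg (Finset.insert_ne_self.2 hn)
  rw [if_pos rfl, mul_zero, zero_add, mul_one] at h1
  rw [← h1]
  refine Finset.sum_pos' (fun S'' _ => mul_nonneg ENNReal.toReal_nonneg ?_)
    ⟨S', Finset.mem_univ _, ?_⟩
  · split_ifs <;> norm_num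
  · rw [if_neg hS, mul_one]
    exact ENNReal.toReal_pos ((PMF.mem_support_iff _ _).1 h) (PMF.apply_ne_top _ _)

theorem matchedSize_insert {n : Fin N} (hn : n ∉ S) (k : Fin C) :
    matchedSize cls (insert n S) k = matchedSize cls S k + if cls n = k then 1 else 0 := by
  rw [matchedSize, Finset.filter_insert]
  split_ifs with h
  · rw [Finset.card_insert_of_notMem fun h' => hn (Finset.mem_filter.1 h').1]
    rfl
  · rfl

/-- The increment in the selected class is a Bernoulli variable whose parameter is the score. This
is the only place where the noise hypothesis is translated into a variance. -/
theorem noiseSecondMoment_self (ha : ∀ c d, 0 ≤ a c d) (haN : ∀ c d, a c d ≤ N) :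
    noiseSecondMoment a ν cls S c c =
      balanceScore a ν cls S c * (1 - balanceScore a ν cls S c) := by
  have h0 : drift a ν cls S c c = balanceScore a ν cls S c := by
    rw [drift, sum_arrival_mul ha haN _ 1]
    · ring
    · intro n hn hc
      rw [matchedSize_insert hn, if_pos hc]
      push_cast
      ring
  rw [noiseSecondMoment, h0, sum_arrival_mul ha haN _ ((1 - balanceScore a ν cls S c) ^ 2)]
  · ring
  · intro n hn hc
    rw [matchedSize_insert hn, if_pos hc]
    push_cast
    ring

end Arrival

/-! ### The trajectories -/

theorem tsum_bind_mul {β γ : Type*} (p : PMF β) (f : β → PMF γ) (h : γ → ENNReal) :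
    ∑' y, p.bind f y * h y = ∑' x, p x * ∑' y, f x y * h y := by
  simp_rw [PMF.bind_apply, ← ENNReal.tsum_mul_right, ← ENNReal.tsum_mul_left, mul_assoc]
  exact ENNReal.tsum_comm

theorem tsum_pure_mul {β : Type*} (x : β) (h : β → ENNReal) : ∑' y, PMF.pure x y * h y = h x := by
  rw [tsum_eq_single x fun y hy => by rw [PMF.pure_apply_of_ne _ _ hy, zero_mul],
    PMF.pure_apply_self, one_mul]

theorem tsum_map_mul {β γ : Type*} (p : PMF β) (f : β → γ) (h : γ → ENNReal) :
    ∑' y, p.map f y * h y = ∑' x, p x * h (f x) := by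
  rw [PMF.map, tsum_bind_mul]
  simp_rw [Function.comp_apply, tsum_pure_mul]

section Run

variable {N C D : ℕ} {a : Fin C → Fin D → ℝ} {ν : PMF (Fin D)} {cls : Fin N → Fin C}
  {sel : ℕ → (ℕ → Finset (Fin N)) → Fin C} {T : ℕ} {ω : ℕ → Finset (Fin N)}

/-- The score of the class that Balance selects. -/
noncomputable def topScore (a : Fin C → Fin D → ℝ) (ν : PMF (Fin D)) (cls : Fin N → Fin C)
    (S : Finset (Fin N)) : ℝ := ⨆ k, balanceScore a ν cls S k

theorem IsBalanceRule.balanceScore_eq (h : IsBalanceRule a ν cls sel) (t : ℕ)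
    (ω : ℕ → Finset (Fin N)) : balanceScore a ν cls (ω t) (sel t ω) = topScore a ν cls (ω t) :=
  have : Nonempty (Fin C) := ⟨sel t ω⟩
  le_antisymm (le_ciSup (f := fun k => balanceScore a ν cls (ω t) k)
    (Set.finite_range _).bddAbove (sel t ω)) (ciSup_le (h t ω))

/-- The trajectories over `T` arrivals that only ever match nodes of a class of maximal, positive
score. -/
def IsPath (a : Fin C → Fin D → ℝ) (ν : PMF (Fin D)) (cls : Fin N → Fin C) (T : ℕ)
    (ω : ℕ → Finset (Fin N)) : Prop :=
  ω 0 = ∅ ∧ ∀ t < T, ω (t + 1) = ω t ∨ ∃ n ∉ ω t, ω (t + 1) = insert n (ω t) ∧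
    0 < balanceScore a ν cls (ω t) (cls n) ∧
    ∀ k, balanceScore a ν cls (ω t) k ≤ balanceScore a ν cls (ω t) (cls n)

theorem isPath_of_mem_support (ha : ∀ c d, 0 ≤ a c d) (haN : ∀ c d, a c d ≤ N)
    (hsel : IsBalanceRule a ν cls sel) :
    ∀ {T : ℕ} {ω : ℕ → Finset (Fin N)}, ω ∈ (run a ν cls sel T).support → IsPath a ν cls T ω := by
  intro T
  induction T with
  | zero =>
    intro ω h
    rw [run, PMF.mem_support_pure_iff] at h
    exact ⟨by rw [h], fun t ht => absurd ht (Nat.not_lt_zero t)⟩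
  | succ T ih =>
    intro ω h
    rw [run, PMF.mem_support_bind_iff] at h
    obtain ⟨ω₀, hω₀, h⟩ := h
    rw [PMF.mem_support_map_iff] at h
    obtain ⟨S, hS, rfl⟩ := h
    obtain ⟨h0, hstep⟩ := ih hω₀
    refine ⟨by simpa using h0, fun t ht => ?_⟩
    rcases Nat.lt_succ_iff_lt_or_eq.1 ht with h | rfl
    · have h' : t + 1 ≤ T := h
      simpa only [h', h.le, if_true] using hstep t h
    · simp only [le_refl, if_true, Nat.not_succ_le_self, if_false]
      by_cases hne : S = ω₀ t
      · exact Or.inl hne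
      obtain h' | ⟨n, hn, hc, rfl⟩ := mem_support_arrival hS
      · exact absurd h' hne
      · refine Or.inr ⟨n, hn, rfl, ?_, ?_⟩
        · rw [hc]; exact balanceScore_pos_of_mem_support ha haN hS hne
        · rw [hc]; exact hsel t ω₀

/-- The compensated number of matched nodes, stopped when it reaches `κ` in absolute value. -/
noncomputable def stoppedNoise (q : Finset (Fin N) → ℝ) (κ : ℝ) : ℕ → (ℕ → Finset (Fin N)) → ℝ
  | 0, _ => 0
  | t + 1, ω => stoppedNoise q κ t ω +
      if |stoppedNoise q κ t ω| < κ then ((ω (t + 1)).card - (ω t).card - q (ω t) : ℝ) else 0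

variable {q : Finset (Fin N) → ℝ} {κ : ℝ}

theorem stoppedNoise_congr {ω' : ℕ → Finset (Fin N)} :
    ∀ {t : ℕ}, (∀ s ≤ t, ω s = ω' s) → stoppedNoise q κ t ω = stoppedNoise q κ t ω'
  | 0, _ => rfl
  | t + 1, h => by
    rw [stoppedNoise, stoppedNoise, stoppedNoise_congr fun s hs => h s (Nat.le_succ_of_le hs),
      h (t + 1) le_rfl, h t (Nat.le_succ t)]

theorem stoppedNoise_stopped {s : ℕ} (hs : κ ≤ |stoppedNoise q κ s ω|) :
    ∀ {t : ℕ}, s ≤ t → stoppedNoise q κ t ω = stoppedNoise q κ s ω := by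
  intro t ht
  induction t, ht using Nat.le_induction with
  | base => rfl
  | succ t _ ih => rw [stoppedNoise, ih, if_neg (not_lt.2 hs), add_zero]

/-- Once the stopped process reaches `κ` it stays where it is. Its final value thus controls the
whole trajectory, and a moment bound at time `T` alone serves as a maximal inequality. -/
theorem abs_card_sub_lt_of_abs_stoppedNoise_lt (h0 : ω 0 = ∅)
    (h : |stoppedNoise q κ T ω| < κ) {t : ℕ} (ht : t ≤ T) :
    |((ω t).card - ∑ s ∈ Finset.range t, q (ω s) : ℝ)| < κ := by
  have h1 : ∀ s ≤ T, |stoppedNoise q κ s ω| < κ := fun s hs => by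
    by_contra! hle
    rw [stoppedNoise_stopped hle hs] at h
    exact absurd h (not_lt.2 hle)
  have h2 : ∀ s ≤ T, stoppedNoise q κ s ω = (ω s).card - ∑ s ∈ Finset.range s, q (ω s) := by
    intro s
    induction s with
    | zero => intro _; simp [stoppedNoise, h0]
    | succ s ih =>
      intro hs
      rw [stoppedNoise, if_pos (h1 s (Nat.le_of_succ_le hs)), ih (Nat.le_of_succ_le hs),
        Finset.sum_range_succ]
      ring
  rw [← h2 t ht]
  exact h1 t ht

/-- Expand around the centred Bernoulli increment: every term beyond `V ^ 4 + μ * V ^ 2` carries the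
variance `q * (1 - q)`, and the term linear in `V` is absorbed into `2 * V ^ 2 + 2`. -/
theorem fourth_moment_step {V q σ μ : ℝ} (hq0 : 0 ≤ q) (hq1 : q ≤ 1) (hσ : q * (1 - q) ≤ σ)
    (hμ : 0 ≤ μ) :
    (1 - q) * ((V - q) ^ 4 + μ * (V - q) ^ 2) + q * ((V + (1 - q)) ^ 4 + μ * (V + (1 - q)) ^ 2) ≤
      V ^ 4 + (8 * σ + μ) * V ^ 2 + (3 + μ) * σ := by
  have hv : 0 ≤ q * (1 - q) := mul_nonneg hq0 (sub_nonneg.2 hq1)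
  have h1 : (1 - q) * ((V - q) ^ 4 + μ * (V - q) ^ 2) +
      q * ((V + (1 - q)) ^ 4 + μ * (V + (1 - q)) ^ 2) =
      V ^ 4 + μ * V ^ 2 + q * (1 - q) * (6 * V ^ 2 + 4 * (V * (1 - 2 * q)) +
        (1 - 3 * (q * (1 - q))) + μ) := by ring
  have h2 : 4 * (V * (1 - 2 * q)) ≤ 2 * V ^ 2 + 2 := by
    nlinarith [sq_nonneg (V - (1 - 2 * q))]
  have h3 : 6 * V ^ 2 + 4 * (V * (1 - 2 * q)) + (1 - 3 * (q * (1 - q))) + μ ≤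
      8 * V ^ 2 + 3 + μ := by linarith
  have h4 : q * (1 - q) * (6 * V ^ 2 + 4 * (V * (1 - 2 * q)) + (1 - 3 * (q * (1 - q))) + μ) ≤
      σ * (8 * V ^ 2 + 3 + μ) :=
    (mul_le_mul_of_nonneg_left h3 hv).trans (mul_le_mul_of_nonneg_right hσ (by positivity))
  rw [h1]
  linarith

/-- One arrival turns the coefficient `μ` of the square into `8 * σ + μ`, so the induction must hold
for all `μ` at once. Accumulating `8 * σ` over the steps yields the term `4 * (σ * T) ^ 2`. -/
theorem tsum_run_fourth_moment_le (ha : ∀ c d, 0 ≤ a c d) (haN : ∀ c d, a c d ≤ N)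
    (hsel : IsBalanceRule a ν cls sel) {σ : ℝ} (hσ0 : 0 ≤ σ) :
    ∀ {T : ℕ}, (∀ t < T, ∀ ω ∈ (run a ν cls sel t).support,
      topScore a ν cls (ω t) * (1 - topScore a ν cls (ω t)) ≤ σ) → ∀ μ : ℝ, 0 ≤ μ →
    ∑' ω, run a ν cls sel T ω * ENNReal.ofReal
      (stoppedNoise (topScore a ν cls) κ T ω ^ 4 + μ * stoppedNoise (topScore a ν cls) κ T ω ^ 2) ≤
      ENNReal.ofReal (4 * (σ * T) ^ 2 + (3 + μ) * (σ * T)) := by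
  intro T
  induction T with
  | zero =>
    intro _ μ _
    rw [run, tsum_pure_mul]
    simp [stoppedNoise]
  | succ T ih =>
    intro hσ μ hμ
    have ih := ih (fun t ht => hσ t (Nat.lt_succ_of_lt ht)) (8 * σ + μ) (by positivity)
    set V := stoppedNoise (topScore a ν cls) κ with hV
    rw [run, tsum_bind_mul]
    simp_rw [tsum_map_mul, tsum_fintype]
    have hstep : ∀ ω, run a ν cls sel T ω * (∑ S, arrival a ν cls (ω T) (sel T ω) S *
        ENNReal.ofReal (V (T + 1) (fun s => if s ≤ T then ω s else S) ^ 4 +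
          μ * V (T + 1) (fun s => if s ≤ T then ω s else S) ^ 2)) ≤
        run a ν cls sel T ω * ENNReal.ofReal (V T ω ^ 4 + (8 * σ + μ) * V T ω ^ 2) +
          run a ν cls sel T ω * ENNReal.ofReal ((3 + μ) * σ) := by
      intro ω
      by_cases hω : ω ∈ (run a ν cls sel T).support
      swap
      · rw [PMF.mem_support_iff, not_not] at hω
        simp [hω]
      rw [← mul_add, ← ENNReal.ofReal_add (by positivity) (by positivity)]
      refine mul_le_mul_right ?_ _
      set q := topScore a ν cls (ω T) with hq
      have hqs : balanceScore a ν cls (ω T) (sel T ω) = q := hsel.balanceScore_eq T ω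
      have hVT : ∀ S, V (T + 1) (fun s => if s ≤ T then ω s else S) =
          V T ω + if |V T ω| < κ then ((S.card : ℝ) - (ω T).card - q) else 0 := by
        intro S
        have hc : V T (fun s => if s ≤ T then ω s else S) = V T ω :=
          stoppedNoise_congr fun s hs => if_pos hs
        rw [hV, stoppedNoise, ← hV, hc]
        simp [hq]
      have hsum : ∑ S, arrival a ν cls (ω T) (sel T ω) S *
          ENNReal.ofReal (V (T + 1) (fun s => if s ≤ T then ω s else S) ^ 4 +
            μ * V (T + 1) (fun s => if s ≤ T then ω s else S) ^ 2) =
          ENNReal.ofReal (∑ S, (arrival a ν cls (ω T) (sel T ω) S).toReal *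
            (V (T + 1) (fun s => if s ≤ T then ω s else S) ^ 4 +
              μ * V (T + 1) (fun s => if s ≤ T then ω s else S) ^ 2)) := by
        rw [ENNReal.ofReal_sum_of_nonneg fun S _ => by positivity]
        refine Finset.sum_congr rfl fun S _ => ?_
        rw [ENNReal.ofReal_mul ENNReal.toReal_nonneg, ENNReal.ofReal_toReal (PMF.apply_ne_top _ _)]
      rw [hsum]
      refine ENNReal.ofReal_le_ofReal ?_
      simp_rw [hVT]
      have hq0 : 0 ≤ q := hqs ▸ poolRate_nonneg ha haN _ _
      have hq1 : q ≤ 1 := hqs ▸ poolRate_le_one haN _ _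
      split_ifs with hκ
      · rw [sum_arrival_mul ha haN (S := ω T) (c := sel T ω) _
          ((V T ω + (1 - q)) ^ 4 + μ * (V T ω + (1 - q)) ^ 2), hqs]
        · convert fourth_moment_step (V := V T ω) hq0 hq1 (hσ T (Nat.lt_succ_self T) ω hω) hμ
            using 3
          ring
        · intro n hn _
          rw [Finset.card_insert_of_notMem hn]
          push_cast
          ring
      · rw [← Finset.sum_mul, sum_toReal_eq_one]
        have : 0 ≤ 8 * σ * V T ω ^ 2 + (3 + μ) * σ := by positivity
        linarith
    refine (ENNReal.tsum_le_tsum hstep).trans ?_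
    rw [ENNReal.tsum_add, ENNReal.tsum_mul_right, PMF.tsum_coe, one_mul]
    refine (add_le_add_left ih _).trans ?_
    rw [← ENNReal.ofReal_add (by positivity) (by positivity)]
    refine ENNReal.ofReal_le_ofReal ?_
    push_cast
    nlinarith [sq_nonneg σ]

/-- A maximal inequality for the compensated number of matched nodes. -/
theorem toOuterMeasure_noise_le (ha : ∀ c d, 0 ≤ a c d) (haN : ∀ c d, a c d ≤ N)
    (hsel : IsBalanceRule a ν cls sel) {σ : ℝ} (hσ0 : 0 ≤ σ)
    (hσ : ∀ t < T, ∀ ω ∈ (run a ν cls sel t).support,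
      topScore a ν cls (ω t) * (1 - topScore a ν cls (ω t)) ≤ σ) (hκ : 0 < κ) :
    (run a ν cls sel T).toOuterMeasure {ω | κ ≤ |stoppedNoise (topScore a ν cls) κ T ω|} ≤
      ENNReal.ofReal ((4 * (σ * T) ^ 2 + 3 * (σ * T)) / κ ^ 4) := by
  have h1 := tsum_run_fourth_moment_le (κ := κ) ha haN hsel hσ0 hσ 0 le_rfl
  simp only [zero_mul, add_zero] at h1
  have hκ4 : 0 < κ ^ 4 := by positivity
  rw [ENNReal.ofReal_div_of_pos hκ4, ENNReal.le_div_iff_mul_le (Or.inl (ENNReal.ofReal_pos.2 hκ4).ne')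
    (Or.inl ENNReal.ofReal_ne_top), PMF.toOuterMeasure_apply, ← ENNReal.tsum_mul_right]
  -- Markov's inequality for the fourth power.
  refine le_trans (ENNReal.tsum_le_tsum fun ω => ?_) h1
  rw [Set.indicator_apply]
  split_ifs with h
  · refine mul_le_mul_right (ENNReal.ofReal_le_ofReal ?_) _
    rw [← Even.pow_abs (by decide : Even 4) (stoppedNoise _ κ T ω)]
    exact pow_le_pow_left₀ hκ.le h 4
  · simp

end Run

/-! ### Comparison of a trajectory with the fluid limit -/

section Path

variable {N C D : ℕ} {a : Fin C → Fin D → ℝ} {ν : PMF (Fin D)} {cls : Fin N → Fin C}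
  {T : ℕ} {ω : ℕ → Finset (Fin N)} {A ℓ : ℝ}

/-- Consider the last match in class `c`: at that moment `c` was maximal, with one matched node
fewer, whence the `- 1` on the right. Later arrivals leave the right side unchanged and can only
lower the scores on the left. -/
theorem IsPath.poolRate_le (ha : ∀ c d, 0 ≤ a c d) (haN : ∀ c d, a c d ≤ N)
    (hω : IsPath a ν cls T ω) : ∀ {t : ℕ}, t ≤ T → ∀ c, 0 < matchedSize cls (ω t) c →
      0 < rowMean a ν c ∧ ∀ k, poolRate N a ν k (classSize cls k - matchedSize cls (ω t) k) ≤
        poolRate N a ν c (classSize cls c - (matchedSize cls (ω t) c - 1)) := by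
  intro t
  induction t with
  | zero => intro _ c hc; simp [hω.1, matchedSize] at hc
  | succ t ih =>
    intro ht c hc
    obtain h | ⟨n, hn, h, hpos, hmax⟩ := hω.2 t ht
    · rw [h] at hc ⊢
      exact ih (Nat.le_of_succ_le ht) c hc
    · rw [h] at hc ⊢
      have hle : ∀ k, poolRate N a ν k (classSize cls k - matchedSize cls (insert n (ω t)) k) ≤
          poolRate N a ν k (classSize cls k - matchedSize cls (ω t) k) := fun k =>
        poolRate_mono ha haN k (Nat.sub_le_sub_left
          (by rw [matchedSize_insert hn]; exact Nat.le_add_right _ _) _)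
      simp only [matchedSize_insert hn c] at hc ⊢
      split_ifs at hc ⊢ with hnc
      · subst hnc
        exact ⟨rowMean_pos_of_poolRate_pos ha hpos, fun k => (hle k).trans (hmax k)⟩
      · obtain ⟨h1, h2⟩ := ih (Nat.le_of_succ_le ht) c hc
        exact ⟨h1, fun k => (hle k).trans (h2 k)⟩

theorem proportion_sub {k : ℕ} {c : Fin C} (hk : k ≤ classSize cls c) :
    proportion cls c - (k : ℝ) / N = ((classSize cls c - k : ℕ) : ℝ) / N := by
  rw [proportion, Nat.cast_sub hk, sub_div]

theorem proportion_nonneg (cls : Fin N → Fin C) (c : Fin C) : 0 ≤ proportion cls c := by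
  unfold proportion; positivity

theorem proportion_le_one (cls : Fin N → Fin C) (c : Fin C) : proportion cls c ≤ 1 :=
  div_le_one_of_le₀ (by exact_mod_cast classSize_le cls c) N.cast_nonneg

theorem abs_balanceScore_sub_fluidRate_le (ha : ∀ c d, 0 ≤ a c d) (hA : ∀ c d, a c d ≤ A)
    (haN : ∀ c d, a c d ≤ N) (S : Finset (Fin N)) (k : Fin C) :
    |balanceScore a ν cls S k - fluidRate a ν k (proportion cls k) (matchedSize cls S k / N)| ≤
      A ^ 2 / N :=
  abs_poolRate_sub_fluidRate_le ha hA haN ((Nat.sub_le _ _).trans (classSize_le cls k))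
    (proportion_sub (matchedSize_le_classSize cls S k))

theorem abs_topScore_sub_le [Nonempty (Fin C)] (ha : ∀ c d, 0 ≤ a c d) (hA : ∀ c d, a c d ≤ A)
    (haN : ∀ c d, a c d ≤ N) (S : Finset (Fin N)) :
    |topScore a ν cls S -
      ⨆ k, fluidRate a ν k (proportion cls k) (matchedSize cls S k / N)| ≤ A ^ 2 / N := by
  have h := fun k => abs_le.1 (abs_balanceScore_sub_fluidRate_le (ν := ν) (cls := cls) ha hA haN S k)
  refine abs_le.2 ⟨?_, ?_⟩
  · rw [neg_le_sub_iff_le_add]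
    refine ciSup_le fun k => ?_
    have h1 := le_ciSup (f := fun k => balanceScore a ν cls S k) (Set.finite_range _).bddAbove k
    have h2 := (h k).1
    simp only [topScore] at h1 ⊢
    linarith
  · rw [sub_le_iff_le_add]
    refine ciSup_le fun k => ?_
    have h1 := apply_le_iSup (fun k => fluidRate a ν k (proportion cls k))
      (fun k => (matchedSize cls S k : ℝ) / N) k
    have h2 := (h k).2
    linarith

theorem IsPath.isFilling (ha : ∀ c d, 0 ≤ a c d) (hA : ∀ c d, a c d ≤ A)
    (haN : ∀ c d, a c d ≤ N)
    (hf : RateFamily (fun c => fluidRate a ν c (proportion cls c)) (proportion cls)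
      (fun c => 0 < rowMean a ν c) ℓ A)
    (hω : IsPath a ν cls T ω) {t : ℕ} (ht : t ≤ T) :
    IsFilling (fun c => fluidRate a ν c (proportion cls c)) (proportion cls)
      (fun c => 0 < rowMean a ν c) ((2 * A ^ 2 + A) / N)
      (fun c => (matchedSize cls (ω t) c : ℝ) / N) := by
  have hle : ∀ c, (matchedSize cls (ω t) c : ℝ) / N ≤ proportion cls c := fun c => by
    have : (matchedSize cls (ω t) c : ℝ) ≤ classSize cls c := by
      exact_mod_cast matchedSize_le_classSize cls (ω t) c
    unfold proportion
    gcongr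
  have hpos : ∀ c, 0 < (matchedSize cls (ω t) c : ℝ) / N → 0 < matchedSize cls (ω t) c := by
    intro c hc
    rw [Nat.pos_iff_ne_zero]
    intro h
    simp [h] at hc
  refine ⟨fun c => by positivity, hle, fun c hc => (hω.poolRate_le ha haN ht c (hpos c hc)).1,
    fun c hc k => ?_⟩
  have hM := hpos c hc
  have h1 := (hω.poolRate_le ha haN ht c hM).2 k
  have h2 := (abs_le.1 (abs_balanceScore_sub_fluidRate_le (ν := ν) (cls := cls) ha hA haN
    (ω t) k)).1
  have hM1 : matchedSize cls (ω t) c - 1 ≤ classSize cls c :=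
    (Nat.sub_le _ _).trans (matchedSize_le_classSize cls (ω t) c)
  have h3 := (abs_le.1 (abs_poolRate_sub_fluidRate_le (ν := ν) (c := c) ha hA haN
    ((Nat.sub_le _ _).trans (classSize_le cls c)) (proportion_sub hM1))).2
  have h4 : ((matchedSize cls (ω t) c - 1 : ℕ) : ℝ) / N ≤ (matchedSize cls (ω t) c : ℝ) / N := by
    gcongr
    exact Nat.sub_le _ _
  have h5 := hf.upper c _ _ (by positivity) h4 (hle c)
  have h6 : A * ((matchedSize cls (ω t) c : ℝ) / N - ((matchedSize cls (ω t) c - 1 : ℕ) : ℝ) / N) =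
      A / N := by
    rw [Nat.cast_sub hM]
    push_cast
    ring
  rw [h6] at h5
  rw [balanceScore_eq] at h2
  -- Two replacements of a score by a fluid rate cost `A ^ 2 / N` each, and undoing the last match
  -- costs `A / N`.
  have h7 : (2 * A ^ 2 + A) / N = 2 * (A ^ 2 / N) + A / N := by ring
  rw [h7]
  linarith

theorem sum_matchedSize (cls : Fin N → Fin C) (S : Finset (Fin N)) :
    ∑ c, (matchedSize cls S c : ℝ) / N = (S.card : ℝ) / N := by
  rw [← Finset.sum_div, Finset.card_eq_sum_card_fiberwise (f := cls) (t := Finset.univ)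
    fun n _ => Finset.mem_coe.2 (Finset.mem_univ _)]
  simp [matchedSize]

/-- A trajectory whose compensated number of matched nodes stays small is close to the fluid
limit. -/
theorem IsPath.abs_sub_le [Nonempty (Fin C)] (ha : ∀ c d, 0 ≤ a c d) (hA0 : 0 ≤ A)
    (hA : ∀ c d, a c d ≤ A) (haN : ∀ c d, a c d ≤ N) (hN : 0 < N)
    (hf : RateFamily (fun c => fluidRate a ν c (proportion cls c)) (proportion cls)
      (fun c => 0 < rowMean a ν c) ℓ A) {α : ℝ} (hT : (T : ℝ) = α * N) {m : ℝ → Fin C → ℝ}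
    (hm : SolvesInclusion (greedyField fun c => fluidRate a ν c (proportion cls c)) α 0 m)
    (hω : IsPath a ν cls T ω) {κ : ℝ}
    (hκ : ∀ t ≤ T, |((ω t).card - ∑ s ∈ Finset.range t, topScore a ν cls (ω s) : ℝ)| ≤ κ)
    {t : ℕ} (ht : t ≤ T) (c : Fin C) :
    |(matchedSize cls (ω t) c : ℝ) / N - m ((t : ℝ) / N) c| ≤
      (2 * κ + (2 * C * ((2 * A ^ 2 + A) / ℓ) + 1 + α * A ^ 2)) / N := by
  have hN' : (0 : ℝ) < N := by exact_mod_cast hN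
  have hα : 0 ≤ α := by
    have : 0 ≤ α * N := hT ▸ T.cast_nonneg
    exact nonneg_of_mul_nonneg_left this hN'
  obtain ⟨hfill, hgint, hsum⟩ := hm.isFilling hf hα
  set f := fun c => fluidRate a ν c (proportion cls c) with hfdef
  set g : ℝ → ℝ := fun τ => ⨆ k, f k (m τ k) with hg
  set θ : ℝ := (2 * A ^ 2 + A) / N / ℓ with hθdef
  have hℓ := hf.pos
  have hθ : 0 ≤ θ := by positivity
  have hρ : ℓ * θ = (2 * A ^ 2 + A) / N := mul_div_cancel₀ _ hℓ.ne'
  have hX : ∀ t ≤ T, IsFilling f (proportion cls) (fun c => 0 < rowMean a ν c) (ℓ * θ)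
      (fun c => (matchedSize cls (ω t) c : ℝ) / N) := fun t ht =>
    hρ ▸ hω.isFilling ha hA haN hf ht
  have hm' : ∀ τ ∈ Icc 0 α, IsFilling f (proportion cls) (fun c => 0 < rowMean a ν c) (ℓ * θ)
      (m τ) := fun τ hτ => (hfill τ hτ).mono (mul_nonneg hℓ.le hθ)
  have hmem : ∀ t ≤ T, (t : ℝ) / N ∈ Icc 0 α := fun t ht => by
    refine ⟨by positivity, (div_le_iff₀ hN').2 ?_⟩
    rw [← hT]
    exact_mod_cast ht
  have hg0 : ∀ τ ∈ Icc 0 α, 0 ≤ g τ := fun τ hτ => (hfill τ hτ).iSup_nonneg hf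
  have hg1 : ∀ τ ∈ Icc 0 α, g τ ≤ 1 := fun τ hτ => (hfill τ hτ).iSup_le_one hf
  have hint : ∀ u ∈ Icc 0 α, ∀ v ∈ Icc 0 α, IntervalIntegrable g volume u v := fun u hu v hv =>
    hgint.mono_set (by rw [uIcc_of_le hα]; exact uIcc_subset_Icc hu hv)
  set s : ℝ → ℝ := fun τ => ∑ c, m τ c with hs
  have hss : ∀ u ∈ Icc 0 α, ∀ v ∈ Icc 0 α, s v - s u = ∫ τ in u..v, g τ := by
    intro u hu v hv
    have h0 : (0 : ℝ) ∈ Icc 0 α := ⟨le_rfl, hα⟩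
    simp only [hs]
    rw [hsum u hu, hsum v hv, intervalIntegral.integral_interval_sub_left
      (hint _ h0 _ hv) (hint _ h0 _ hu)]
  have hint_le : ∀ u ∈ Icc 0 α, ∀ v ∈ Icc 0 α, u ≤ v → ∀ p, (∀ τ ∈ Icc u v, g τ ≤ p) →
      s v - s u ≤ (v - u) * p := by
    intro u hu v hv huv p hp
    rw [hss u hu v hv, ← smul_eq_mul, ← intervalIntegral.integral_const]
    exact intervalIntegral.integral_mono_on huv (hint u hu v hv) intervalIntegrable_const hp
  have le_hint : ∀ u ∈ Icc 0 α, ∀ v ∈ Icc 0 α, u ≤ v → ∀ p, (∀ τ ∈ Icc u v, p ≤ g τ) →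
      (v - u) * p ≤ s v - s u := by
    intro u hu v hv huv p hp
    rw [hss u hu v hv, ← smul_eq_mul, ← intervalIntegral.integral_const]
    exact intervalIntegral.integral_mono_on huv intervalIntegrable_const (hint u hu v hv) hp
  have hsmono : ∀ u ∈ Icc 0 α, ∀ v ∈ Icc 0 α, u ≤ v → s u ≤ s v := by
    intro u hu v hv huv
    have := le_hint u hu v hv huv 0 fun τ hτ => hg0 τ ⟨hu.1.trans hτ.1, hτ.2.trans hv.2⟩
    linarith
  set Z : ℕ → ℝ := fun t =>
    (∑ s ∈ Finset.range t, topScore a ν cls (ω s)) / N - s ((t : ℝ) / N) with hZ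
  have hq : ∀ t ≤ T, topScore a ν cls (ω t) ≤ 1 ∧ 0 ≤ topScore a ν cls (ω t) := by
    intro t _
    refine ⟨ciSup_le fun k => poolRate_le_one haN _ _, ?_⟩
    obtain ⟨k⟩ := ‹Nonempty (Fin C)›
    exact (poolRate_nonneg ha haN _ _).trans (le_ciSup
      (f := fun k => balanceScore a ν cls (ω t) k) (Set.finite_range _).bddAbove k)
  -- `Z` compares the accumulated scores with the fluid total. Outside a band of width `C * θ + κ /
  -- N` monotonicity pushes it back, up to `A ^ 2 / N` in rate; within the band one step of length
  -- `1 / N` moves it by at most `1 / N`. Errors therefore only add up.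
  have key : ∀ t ≤ T, |Z t| ≤ C * θ + κ / N + 1 / N + t * (A ^ 2 / N / N) := by
    have hs0 : s 0 = 0 := by
      simp only [hs]
      rw [hsum 0 ⟨le_rfl, hα⟩, intervalIntegral.integral_same]
    have hκ0 : 0 ≤ κ := (abs_nonneg _).trans (hκ 0 (Nat.zero_le T))
    intro t
    induction t with
    | zero =>
      intro _
      simp only [hZ, Finset.range_zero, Finset.sum_empty, zero_div, Nat.cast_zero, hs0, sub_self,
        abs_zero, zero_mul, add_zero]
      positivity
    | succ t ih =>
      intro ht
      have ht' : t ≤ T := Nat.le_of_succ_le ht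
      obtain ⟨ih1, ih2⟩ := abs_le.1 (ih ht')
      set u : ℝ := (t : ℝ) / N with hu
      set v : ℝ := ((t + 1 : ℕ) : ℝ) / N with hv
      have huv : v - u = 1 / N := by rw [hu, hv]; push_cast; ring
      have huv' : u ≤ v := by
        have : 0 < 1 / (N : ℝ) := by positivity
        linarith
      have hum := hmem t ht'
      have hvm := hmem (t + 1) ht
      have hsub : Icc u v ⊆ Icc 0 α := Icc_subset_Icc hum.1 hvm.2
      have hZs : Z (t + 1) = Z t + (1 / N * topScore a ν cls (ω t) - (s v - s u)) := by
        simp only [hZ, ← hu, ← hv, Finset.sum_range_succ]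
        ring
      have hcard : ((ω t).card : ℝ) / N - s u =
          Z t + ((ω t).card - ∑ s ∈ Finset.range t, topScore a ν cls (ω s)) / N := by
        simp only [hZ, ← hu]
        ring
      obtain ⟨hW1, hW2⟩ := abs_le.1 (hκ t ht')
      have hW1' := div_le_div_of_nonneg_right hW1 hN'.le
      have hW2' := div_le_div_of_nonneg_right hW2 hN'.le
      rw [neg_div] at hW1'
      obtain ⟨hd1, hd2⟩ := abs_le.1 (abs_topScore_sub_le (ν := ν) (cls := cls) ha hA haN (ω t))
      have hXs := sum_matchedSize cls (ω t)
      have hr : 0 ≤ A ^ 2 / N / N := by positivity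
      have ht0 : 0 ≤ (t : ℝ) * (A ^ 2 / N / N) := by positivity
      have hq1 : 1 / N * topScore a ν cls (ω t) ≤ 1 / N :=
        mul_le_of_le_one_right (by positivity) (hq t ht').1
      have hq0 : 0 ≤ 1 / N * topScore a ν cls (ω t) := mul_nonneg (by positivity) (hq t ht').2
      have hp : 1 / (N : ℝ) * (A ^ 2 / N) = A ^ 2 / N / N := by ring
      rw [hZs, abs_le]
      push_cast
      refine ⟨?_, ?_⟩
      · rcases lt_or_ge ((ω t).card / N + C * θ : ℝ) (s u) with h | h
        · have h1 := hint_le u hum v hvm huv' (topScore a ν cls (ω t) + A ^ 2 / N) fun τ hτ => by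
            have h2 := hsmono u hum τ (hsub hτ) hτ.1
            have h3 := (hm' τ (hsub hτ)).iSup_le_iSup hf (hX t ht') hθ
              (by rw [hXs, Fintype.card_fin]; exact h.trans_le h2)
            simp only [hg]
            linarith
          rw [huv, mul_add, hp] at h1
          linarith
        · have h1 := hint_le u hum v hvm huv' 1 fun τ hτ => hg1 τ (hsub hτ)
          rw [huv, mul_one] at h1
          linarith
      -- The comparison is made at the right end `v`, since the trajectory must stay ahead of the
      -- increasing fluid total throughout the step.
      · rcases lt_or_ge (s v + C * θ) ((ω t).card / N : ℝ) with h | h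
        · have h1 := le_hint u hum v hvm huv' (topScore a ν cls (ω t) - A ^ 2 / N) fun τ hτ => by
            have h2 := hsmono τ (hsub hτ) v hvm hτ.2
            have h3 := (hX t ht').iSup_le_iSup hf (hm' τ (hsub hτ)) hθ
              (by rw [hXs, Fintype.card_fin]; exact (add_le_add_left h2 _).trans_lt h)
            simp only [hg]
            linarith
          rw [huv, mul_sub, hp] at h1
          linarith
        · linarith
  have h1 := (hX t ht).abs_sub_le hf (hm' _ (hmem t ht)) hθ c
  rw [sum_matchedSize, Fintype.card_fin] at h1
  have h2 : ((ω t).card : ℝ) / N - s ((t : ℝ) / N) =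
      Z t + ((ω t).card - ∑ s ∈ Finset.range t, topScore a ν cls (ω s)) / N := by
    simp only [hZ]
    ring
  have h3 : |((ω t).card - ∑ s ∈ Finset.range t, topScore a ν cls (ω s) : ℝ) / N| ≤ κ / N := by
    rw [abs_div, abs_of_pos hN']
    exact div_le_div_of_nonneg_right (hκ t ht) hN'.le
  have h4 := abs_add_le (Z t) (((ω t).card - ∑ s ∈ Finset.range t, topScore a ν cls (ω s)) / N)
  rw [← h2] at h4
  have h5 : (t : ℝ) * (A ^ 2 / N / N) ≤ α * A ^ 2 / N := by
    have h6 : (t : ℝ) ≤ α * N := by rw [← hT]; exact_mod_cast ht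
    calc (t : ℝ) * (A ^ 2 / N / N) ≤ α * N * (A ^ 2 / N / N) :=
          mul_le_mul_of_nonneg_right h6 (by positivity)
      _ = α * A ^ 2 / N := by field_simp
  have h7 : (2 * κ + (2 * C * ((2 * A ^ 2 + A) / ℓ) + 1 + α * A ^ 2)) / N =
      2 * (κ / N) + 2 * (C * θ) + 1 / N + α * A ^ 2 / N := by
    rw [hθdef]
    field_simp
    ring
  rw [h7]
  have h8 := key t ht
  simp only [hs] at h4
  linarith

end Path

/-! ### The error bound -/

section ErrorBound

variable {C D : ℕ} {a : Fin C → Fin D → ℝ} {ν : PMF (Fin D)} {α : ℝ}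

/-- Only two terms under the root are needed. As `kConst` is at least `α`, the term with `cConst` is
at least `8 * α * ε`, and the bias times `bConst` is at least a constant over `N`; everything else
is nonnegative. The constant `r` depends on neither `N`, `b` nor `ε`. -/
theorem exists_mul_sqrt_le_errorBound (ha : ∀ c d, 0 ≤ a c d) (hα : 0 < α) (c : Fin C)
    (hc : ∀ d, 0 < a c d) :
    ∃ r > 0, ∀ N : ℕ, (∀ c d, a c d < N) → ∀ b : Fin C → ℝ, (∀ c, 0 ≤ b c) → ∀ ε : ℝ, 0 < ε →
      r * Real.sqrt (ε + 1 / N) ≤ errorBound N a ν b α ε c := by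
  have hne : Nonempty (Fin D) := let ⟨d, _⟩ := ν.support_nonempty; ⟨d⟩
  obtain ⟨d₀, hd₀⟩ := ν.support_nonempty
  have hd₀' : 0 < (ν d₀).toReal :=
    ENNReal.toReal_pos ((PMF.mem_support_iff _ _).1 hd₀) (PMF.apply_ne_top _ _)
  have hrow : 0 < ∑ d, a c d * (ν d).toReal :=
    Finset.sum_pos' (fun d _ => mul_nonneg (ha c d) ENNReal.toReal_nonneg)
      ⟨d₀, Finset.mem_univ _, mul_pos (hc d₀) hd₀'⟩
  have hbias : 0 < ∑ d, a c d / Real.exp 1 * (ν d).toReal :=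
    Finset.sum_pos' (fun d _ => mul_nonneg (div_nonneg (ha c d) (Real.exp_pos 1).le)
      ENNReal.toReal_nonneg) ⟨d₀, Finset.mem_univ _, mul_pos (div_pos (hc d₀) (Real.exp_pos 1)) hd₀'⟩
  set β := ∑ d, a c d / Real.exp 1 * (ν d).toReal with hβ
  have hL : 0 < lipConst a ν :=
    hrow.trans_le (le_ciSup (f := fun c => ∑ d, a c d * (ν d).toReal)
      (Set.finite_range _).bddAbove c)
  set μ := min α (Real.exp (lipConst a ν * α) / Real.sqrt (2 * lipConst a ν)) with hμ
  have hμ0 : 0 < μ := lt_min hα (by positivity)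
  set w := min (8 * α) (12 * α * β) with hw
  have hw0 : 0 < w := lt_min (by positivity) (by positivity)
  refine ⟨μ * Real.sqrt w, by positivity, fun N hN b hb ε hε => ?_⟩
  have hN' : (0 : ℝ) < N := (ha c d₀).trans_lt (hN c d₀)
  rw [errorBound, mul_assoc, ← Real.sqrt_mul hw0.le]
  refine mul_le_mul_of_nonneg_left (Real.sqrt_le_sqrt ?_) hμ0.le
  have hU : 0 ≤ uConst a ν b c := by
    refine Finset.sum_nonneg fun d _ => mul_nonneg (sub_nonneg.2 (Real.exp_le_one_iff.2 ?_))
      ENNReal.toReal_nonneg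
    exact neg_nonpos.2 (mul_nonneg (ha c d) (hb c))
  have hκ : 0 < growthConst N a b c := by
    refine lt_max_of_lt_right (abs_pos.2 (mul_ne_zero ?_ (Real.exp_pos _).ne'))
    obtain ⟨d₁, hd₁⟩ := exists_eq_ciInf_of_finite (f := fun d => a c d)
    refine (Real.log_neg ?_ ?_).ne
    · rw [← hd₁, sub_pos, div_lt_one hN']
      exact hN c d₁
    · rw [← hd₁]
      have := div_pos (hc d₁) hN'
      linarith
  have hK : α ≤ kConst N a b α ε c := by
    rw [kConst, le_div_iff₀ hκ]
    have h1 : 1 ≤ Real.exp (growthConst N a b c * α) := Real.one_le_exp (by positivity)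
    have h2 : 0 ≤ growthConst N a b c * α := by positivity
    nlinarith
  have hKn : 0 ≤ kConst N a b α ε c := hα.le.trans hK
  have hA : 0 ≤ aConst N a ν b α ε c / N := by unfold aConst; positivity
  have hδ : biasConst N a ν c = 1 / N * β := rfl
  have hδ0 : 0 ≤ biasConst N a ν c := by rw [hδ]; positivity
  have hB : 12 * α ≤ bConst N a ν b α ε c := by
    unfold bConst
    have : 0 ≤ 2 * uConst a ν b c ^ 2 + 4 * lipConst a ν * biasConst N a ν c := by positivity
    linarith
  have hC : 8 * α ≤ cConst N a ν b α ε c := by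
    unfold cConst
    have : 0 ≤ 2 * uConst a ν b c ^ 2 + 4 * lipConst a ν * ε := by positivity
    linarith
  have h1 : w * ε ≤ ε * cConst N a ν b α ε c := by
    rw [mul_comm]
    exact mul_le_mul_of_nonneg_left ((min_le_left _ _).trans hC) hε.le
  have h2 : w * (1 / N) ≤ biasConst N a ν c * bConst N a ν b α ε c := by
    calc w * (1 / N) ≤ 12 * α * β * (1 / N) :=
          mul_le_mul_of_nonneg_right (min_le_right _ _) (by positivity)
      _ = biasConst N a ν c * (12 * α) := by rw [hδ]; ring
      _ ≤ _ := mul_le_mul_of_nonneg_left hB hδ0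
  linarith

end ErrorBound

/-- The concentration of the trajectories of Balance around the fluid limit. -/
theorem concentration {C D : ℕ} (hC : 0 < C) {a : Fin C → Fin D → ℝ} (ha : ∀ c d, 0 ≤ a c d)
    (ν : PMF (Fin D)) {α : ℝ} (hα : 0 < α) :
    ∃ N₀ : ℕ, ∀ N : ℕ, N₀ ≤ N → (∀ c d, a c d < N) → ∀ T : ℕ, (T : ℝ) = α * N →
      ∀ (cls : Fin N → Fin C) (sel : ℕ → (ℕ → Finset (Fin N)) → Fin C),
        IsBalanceRule a ν cls sel →
      ∀ m : ℝ → Fin C → ℝ,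
        SolvesInclusion (greedyField fun c => fluidRate a ν c (proportion cls c)) α 0 m →
      ∀ σ : ℝ, 0 < σ → NoiseBound a ν cls sel T σ → ∀ ε : ℝ, 0 < ε →
        ENNReal.ofReal (1 - σ * α / (N * ε ^ 2)) ≤ (run a ν cls sel T).toOuterMeasure
          {ω | ∀ t ≤ T, ∀ c, (∀ d, 0 < a c d) →
            |(matchedSize cls (ω t) c : ℝ) / N - m ((t : ℝ) / N) c| ≤
              errorBound N a ν (proportion cls) α ε c} := by
  have : Nonempty (Fin C) := ⟨⟨0, hC⟩⟩
  obtain ⟨A, hA0, hA⟩ : ∃ A, 0 ≤ A ∧ ∀ c d, a c d ≤ A :=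
    ⟨∑ c, ∑ d, a c d, Finset.sum_nonneg fun c _ => Finset.sum_nonneg fun d _ => ha c d, fun c d =>
      (Finset.single_le_sum (fun d _ => ha c d) (Finset.mem_univ d)).trans
        (Finset.single_le_sum (f := fun c => ∑ d, a c d)
          (fun c _ => Finset.sum_nonneg fun d _ => ha c d) (Finset.mem_univ c))⟩
  obtain ⟨ℓ, hℓ⟩ := exists_rateFamily (ν := ν) ha hA0 hA 1
  choose r' hr' hle' using fun c : {c // ∀ d, 0 < a c d} =>
    exists_mul_sqrt_le_errorBound (ν := ν) ha hα c c.2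
  obtain ⟨r, hr, hrr⟩ := exists_pos_le_of_finite (fun _ : {c // ∀ d, 0 < a c d} => True) r'
    fun c _ => hr' c
  set K := 2 * C * ((2 * A ^ 2 + A) / ℓ) + 1 + α * A ^ 2 with hK
  -- The first summand makes the deterministic error `K / N` fit into half of the allowed deviation;
  -- the second makes the spare factor `1 / N` in the probability beat its constants.
  refine ⟨⌈4 * K ^ 2 / r ^ 2⌉₊ + ⌈256 * (4 * α + 3) / r ^ 4⌉₊ + 1, fun N hN haN T hT cls sel hsel m
    hm σ hσ0 hσ ε hε => ?_⟩
  have haN' : ∀ c d, a c d ≤ N := fun c d => (haN c d).le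
  have hN0 : 0 < N := by omega
  have hN1 : (1 : ℝ) ≤ N := by exact_mod_cast hN0
  have hN' : (0 : ℝ) < N := by linarith
  have hNK : 4 * K ^ 2 ≤ N * r ^ 2 := by
    rw [← div_le_iff₀ (by positivity)]
    refine (Nat.le_ceil _).trans ?_
    exact_mod_cast (by omega : ⌈4 * K ^ 2 / r ^ 2⌉₊ ≤ N)
  have hNα : 256 * (4 * α + 3) ≤ N * r ^ 4 := by
    rw [← div_le_iff₀ (by positivity)]
    refine (Nat.le_ceil _).trans ?_
    exact_mod_cast (by omega : ⌈256 * (4 * α + 3) / r ^ 4⌉₊ ≤ N)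
  have hf := hℓ (proportion cls) (proportion_nonneg cls) (proportion_le_one cls)
  -- Capping `σ` at 1 is harmless for a Bernoulli variance and makes the fourth moment bound linear
  -- in `σ`, even for large `σ`.
  have hv : ∀ t < T, ∀ ω ∈ (run a ν cls sel t).support,
      topScore a ν cls (ω t) * (1 - topScore a ν cls (ω t)) ≤ min σ 1 := by
    intro t ht ω hω
    have h1 := hσ t ht ω hω (sel t ω)
    rw [noiseSecondMoment_self ha haN', hsel.balanceScore_eq] at h1
    refine le_min h1 ?_
    nlinarith [sq_nonneg (topScore a ν cls (ω t) - 1 / 2)]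
  set R := Real.sqrt (ε + 1 / N) with hR
  have hε1 : 0 < ε + 1 / (N : ℝ) := by positivity
  have hR0 : 0 < R := Real.sqrt_pos.2 hε1
  have hR2 : R ^ 2 = ε + 1 / N := Real.sq_sqrt hε1.le
  -- The deviation costs `2 * κ / N`, which uses exactly half of `r * R`.
  set κ := N * (r / 4 * R) with hκ
  have hκ0 : 0 < κ := by positivity
  have hbad := toOuterMeasure_noise_le (κ := κ) ha haN' hsel (le_min hσ0.le zero_le_one) hv hκ0
  set p := run a ν cls sel T with hp
  set bad := {ω | κ ≤ |stoppedNoise (topScore a ν cls) κ T ω|} with hbaddef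
  set good := {ω : ℕ → Finset (Fin N) | ∀ t ≤ T, ∀ c, (∀ d, 0 < a c d) →
            |(matchedSize cls (ω t) c : ℝ) / N - m ((t : ℝ) / N) c| ≤
              errorBound N a ν (proportion cls) α ε c} with hgood
  have hcover : p.support ⊆ good ∪ bad := by
    intro ω hω
    by_cases hωb : ω ∈ bad
    · exact Or.inr hωb
    refine Or.inl fun t ht c hc => ?_
    have hpath := isPath_of_mem_support ha haN' hsel hω
    have h1 := hpath.abs_sub_le ha hA0 hA haN' hN0 hf hT hm (κ := κ)
      (fun t ht => (abs_card_sub_lt_of_abs_stoppedNoise_lt hpath.1 (not_le.1 hωb) ht).le) ht c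
    refine h1.trans (le_trans ?_ (hle' ⟨c, hc⟩ N haN _ (proportion_nonneg cls) ε hε))
    refine le_trans ?_ (mul_le_mul_of_nonneg_right (hrr ⟨c, hc⟩ trivial) hR0.le)
    have h2 : K ≤ N * (r / 2 * R) := by
      refine le_of_sq_le_sq ?_ (by positivity)
      have h3 : (N * (r / 2 * R)) ^ 2 = N * r ^ 2 / 4 * (N * ε + 1) := by
        rw [mul_pow, mul_pow, hR2]
        field_simp
        norm_num
      rw [h3]
      have h4 : 0 ≤ N * ε := by positivity
      nlinarith
    rw [div_le_iff₀ hN', hκ]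
    linarith
  have hprob : (4 * (min σ 1 * T) ^ 2 + 3 * (min σ 1 * T)) / κ ^ 4 ≤ σ * α / (N * ε ^ 2) := by
    have hT0 : 0 ≤ (T : ℝ) := T.cast_nonneg
    have hs0 : 0 ≤ min σ 1 := le_min hσ0.le zero_le_one
    have h1 : 4 * (min σ 1 * T) ^ 2 + 3 * (min σ 1 * T) ≤ σ * T * (4 * T + 3) := by
      have h2 : min σ 1 * T ≤ σ * T := mul_le_mul_of_nonneg_right (min_le_left _ _) hT0
      have h3 : min σ 1 * T ≤ T := mul_le_of_le_one_left hT0 (min_le_right _ _)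
      have h4 : 0 ≤ min σ 1 * T := mul_nonneg hs0 hT0
      nlinarith [mul_le_mul h2 h3 h4 (by positivity)]
    have h5 : κ ^ 4 = N ^ 4 * (r ^ 4 / 256) * (ε + 1 / N) ^ 2 := by
      rw [hκ, ← hR2]; ring
    have h6 : N ^ 4 * (r ^ 4 / 256) * ε ^ 2 ≤ κ ^ 4 := by
      rw [h5]
      have : 0 ≤ 1 / (N : ℝ) := by positivity
      gcongr
      linarith
    rw [div_le_div_iff₀ (by positivity) (by positivity)]
    calc _ ≤ σ * T * (4 * T + 3) * (N * ε ^ 2) := by gcongr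
      _ ≤ σ * α * N * (N * (N * r ^ 4 / 256)) * (N * ε ^ 2) := by
          have h7 : 4 * (T : ℝ) + 3 ≤ N * (N * r ^ 4 / 256) := by
            rw [hT]
            nlinarith
          rw [hT, ← mul_assoc σ α, ← hT]
          gcongr
      _ = σ * α * (N ^ 4 * (r ^ 4 / 256) * ε ^ 2) := by ring
      _ ≤ _ := by gcongr
  rw [ENNReal.ofReal_sub _ (by positivity), ENNReal.ofReal_one, tsub_le_iff_right,
    ← (p.toOuterMeasure_apply_eq_one_iff _).2 hcover]
  exact (measure_union_le good bad).trans
    (add_le_add_right (hbad.trans (ENNReal.ofReal_le_ofReal hprob)) _)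

end BalanceSBM

theorem mainTheorem1 (C D : ℕ) (hC : 0 < C) (a : Fin C → Fin D → ℝ) (ha : ∀ c d, 0 ≤ a c d)
    (ν : PMF (Fin D)) (α : ℝ) (hα : 0 < α) :
    (∀ b : Fin C → ℝ, (∀ c, 0 ≤ b c) →
      ∃ m : ℝ → Fin C → ℝ,
        BalanceSBM.SolvesInclusion (BalanceSBM.fluidField a ν b) α 0 m ∧
        ∀ m' : ℝ → Fin C → ℝ,
          BalanceSBM.SolvesInclusion (BalanceSBM.fluidField a ν b) α 0 m' →
            Set.EqOn m' m (Set.Icc 0 α)) ∧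
    ∃ N₀ : ℕ, ∀ N : ℕ, N₀ ≤ N → (∀ c d, a c d < N) →
      ∀ T : ℕ, (T : ℝ) = α * N →
      ∀ (cls : Fin N → Fin C) (sel : ℕ → (ℕ → Finset (Fin N)) → Fin C),
        BalanceSBM.IsBalanceRule a ν cls sel →
      ∀ m : ℝ → Fin C → ℝ,
        BalanceSBM.SolvesInclusion
          (BalanceSBM.fluidField a ν (BalanceSBM.proportion cls)) α 0 m →
      ∀ σ : ℝ, 0 < σ → BalanceSBM.NoiseBound a ν cls sel T σ →
      ∀ ε : ℝ, 0 < ε →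
        ENNReal.ofReal (1 - σ * α / (N * ε ^ 2)) ≤
          (BalanceSBM.run a ν cls sel T).toOuterMeasure
            {ω | ∀ t ≤ T, ∀ c, (∀ d, 0 < a c d) →
              |(BalanceSBM.matchedSize cls (ω t) c : ℝ) / N - m ((t : ℝ) / N) c| ≤
                BalanceSBM.errorBound N a ν (BalanceSBM.proportion cls) α ε c} := by
  -- `fluidField` and `greedyField` of the fluid rates agree by unfolding, so the general results
  -- apply directly.
  refine ⟨fun b hb => ?_, BalanceSBM.concentration hC ha ν hα⟩
  have : Nonempty (Fin C) := ⟨⟨0, hC⟩⟩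
  obtain ⟨A, hA⟩ := (Set.finite_range fun x : Fin C × Fin D => a x.1 x.2).bddAbove
  obtain ⟨β, hβ⟩ := (Set.finite_range b).bddAbove
  obtain ⟨ℓ, hℓ⟩ := BalanceSBM.exists_rateFamily (A := max A 0) (ν := ν) ha (le_max_right _ _)
    (fun c d => le_max_of_le_left (hA ⟨(c, d), rfl⟩)) β
  have hf := hℓ b hb fun c => hβ ⟨c, rfl⟩
  obtain ⟨m, hm⟩ := BalanceSBM.exists_solvesInclusion hf hα.le
  exact ⟨m, hm, fun m' hm' => BalanceSBM.SolvesInclusion.eqOn hf hm' hm⟩
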